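/- Let $G$ be a connected finite graph (loops and multiple edges allowed) with edge set $E$ and a fixed reference orientation. Directed cycles and directed cocycles (a cocycle is a nonempty cut that is minimal for inclusion) are written as $\{0,\pm1\}$-vectors in $\mathbb{R}^E$ with respect to the reference orientation, orientations as vectors in $\{0,1\}^E$ (with $(1,\dots,1)$ the reference orientation), and continuous orientations as points of $[0,1]^E$; an edge is bi-oriented in a continuous orientation if its coordinate lies in $(0,1)$. Reversing a directed cycle or cocycle $\overrightarrow{C}$ contained in an orientation $O$ gives $O-\overrightarrow{C}$. A cycle (cocycle) signature chooses one direction $\sigma(C)$ for each cycle (cocycle) $C$; it is acyclic if $\sum_C a_C\,\sigma(C)=0$ with all $a_C\ge 0$ implies that all $a_C=0$. Let $\sigma$ be an acyclic cycle signature and $\sigma^*$ an acyclic cocycle signature. An orientation is $\sigma$-compatible ($\sigma^*$-compatible) if each directed cycle (cocycle) in it is the chosen one, and $(\sigma,\sigma^*)$-compatible if it is both. A continuous orientation $x$ is $\sigma$-compatible if $x+\epsilon\,\sigma(C)\notin[0,1]^E$ for every $\epsilon>0$ and every cycle $C$; let $S_\sigma$ be the set of these. For a spanning tree $T$ let $g_{\sigma,\sigma^*}(T)$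 be the orientation in which each $e\notin T$ is oriented as in $\sigma(C)$, where $C$ is the unique cycle in $T\cup\{e\}$, and each $e\in T$ as in $\sigma^*(C^*)$, where $C^*$ is the unique cocycle in $(E\setminus T)\cup\{e\}$. If an orientation $O$ is obtained from a $(\sigma,\sigma^*)$-compatible orientation $O^{cp}=g_{\sigma,\sigma^*}(T)$ by reversing disjoint directed cycles $\{\overrightarrow{C_i}\}_{i\in I}$ and directed cocycles $\{\overrightarrow{C_j^*}\}_{j\in J}$ in $O^{cp}$, put $$\varphi_{\sigma,\sigma^*}(O)=\Bigl(T\cup\biguplus_{i\in I}C_i\Bigr)\setminus\biguplus_{j\in J}C_j^*.$$ For an orientation $O$ and $S\subseteq E$ let $\mathrm{hoc}(O,S)$ be the set of continuous orientations in which each edge $e\notin S$ is oriented as in $O$ and each edge $e\in S$ is oriented as in $O$ or bi-oriented. A standard half-open cell with lattice point $a\in\mathbb{Z}^E$ and generating set $S$ is a product $\prod_{e\in E}I_e$ with $I_e=\{a_e\}$ for $e\notin S$ and $I_e=(a_e-1,a_e]$ or $[a_e,a_e+1)$ for $e\in S$. Then every orientation $O$ arises as above, $\varphi_{\sigma,\sigma^*}(O)$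 does not depend on the choices, and $$S_\sigma=\biguplus_{O\in\{0,1\}^E\ \sigma\text{-compatible}}\mathrm{hoc}\bigl(O,\varphi_{\sigma,\sigma^*}(O)\bigr).$$ Moreover: - each $\mathrm{hoc}(O,\varphi_{\sigma,\sigma^*}(O))$ is a standard half-open cell with lattice point $O$ and generating set $\varphi_{\sigma,\sigma^*}(O)$; - $[0,1]^E=\biguplus_{O\in\{0,1\}^E}\mathrm{hoc}(O,\varphi_{\sigma,\sigma^*}(O))$, and this tiling restricts to that of $S_\sigma$: the cell of $O$ is contained in $S_\sigma$ if $O$ is $\sigma$-compatible and is disjoint from $S_\sigma$ otherwise; - sending the lattice point of a cell to its generating set, $O\mapsto\varphi_{\sigma,\sigma^*}(O)$, is a bijection from the $\sigma$-compatible orientations to the spanning forests of $G$ (subsets of $E$ containing no cycle); for $\sigma$-compatible $O$ one always has $I=\emptyset$, so $\varphi_{\sigma,\sigma^*}(O)=T\setminus\biguplus_{j\in J}C_j^*$. -/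

import Mathlib

/-- A multigraph (loops and multiple edges allowed) on the vertex type `V` with edge type `E`,
together with a reference orientation: every edge has a tail and a head. -/
structure OrientedMultigraph (V E : Type*) where
  tail : E → V
  head : E → V

namespace OrientedMultigraph

/-! ### Subgraphs, cycles, cocycles

A directed cycle, a directed cocycle and, more generally, a set of arcs is written as a
`{0, 1, -1}`-vector indexed by the edges: `1` stands for the arc of the reference orientation, `-1`
for the opposite arc, `0` for an edge that is not used. A loop has two directions as well. -/

/-- The spanning subgraph with edge set `S` joins any two vertices by a path. -/
def ConnectsAll {V E : Type*} (G : OrientedMultigraph V E) (S : Set E) : Prop :=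
  ∀ u v : V, Relation.ReflTransGen
    (fun a b => ∃ e ∈ S, (G.tail e = a ∧ G.head e = b) ∨ (G.tail e = b ∧ G.head e = a)) u v

/-- The graph is connected. -/
def IsConnected {V E : Type*} (G : OrientedMultigraph V E) : Prop :=
  Nonempty V ∧ G.ConnectsAll Set.univ

/-- `c` is a directed cycle: there are distinct vertices `v 0, …, v n` and distinct edges
`a 0, …, a n` such that `c` consists of one arc over each `a i`, directed from `v i` to `v (i + 1)`,
where `v (n + 1) = v 0` (addition in `Fin (n + 1)` is cyclic). The case `n = 0` is a loop. -/
def IsDirectedCycle {V E : Type*} (G : OrientedMultigraph V E) (c : E → ℝ) : Prop :=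
  ∃ (n : ℕ) (v : Fin (n + 1) → V) (a : Fin (n + 1) → E),
    Function.Injective v ∧ Function.Injective a ∧
    (∀ i, (c (a i) = 1 ∧ G.tail (a i) = v i ∧ G.head (a i) = v (i + 1)) ∨
      (c (a i) = -1 ∧ G.head (a i) = v i ∧ G.tail (a i) = v (i + 1))) ∧
    ∀ e, e ∉ Set.range a → c e = 0

/-- A set of edges is a cycle if it underlies a directed cycle. -/
def IsCycle {V E : Type*} (G : OrientedMultigraph V E) (C : Set E) : Prop :=
  ∃ c, G.IsDirectedCycle c ∧ Function.support c = C

/-- The cut of `W`: the edges with one endpoint in `W` and the other one not in `W`. -/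
def cut {V E : Type*} (G : OrientedMultigraph V E) (W : Set V) : Set E :=
  {e | (G.tail e ∈ W ∧ G.head e ∉ W) ∨ (G.tail e ∉ W ∧ G.head e ∈ W)}

/-- A cocycle is a (nonempty) cut that is minimal for inclusion. -/
def IsCocycle {V E : Type*} (G : OrientedMultigraph V E) (C : Set E) : Prop :=
  Minimal (fun D : Set E => D.Nonempty ∧ ∃ W : Set V, D = G.cut W) C

open Classical in
/-- The cut of `W` with every edge directed from `W` to its complement. -/
noncomputable def cutVector {V E : Type*} (G : OrientedMultigraph V E) (W : Set V) : E → ℝ :=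
  fun e =>
    if G.tail e ∈ W ∧ G.head e ∉ W then 1
    else if G.tail e ∉ W ∧ G.head e ∈ W then -1
    else 0

/-- `d` is a directed cocycle: a cocycle all of whose edges are directed from one side of the cut
to the other. (The opposite direction is obtained by replacing `W` by its complement.) -/
def IsDirectedCocycle {V E : Type*} (G : OrientedMultigraph V E) (d : E → ℝ) : Prop :=
  ∃ W : Set V, G.IsCocycle (G.cut W) ∧ d = G.cutVector W

/-- A spanning forest, as a set of edges. -/
def IsSpanningForest {V E : Type*} (G : OrientedMultigraph V E) (F : Set E) : Prop :=
  ∀ C, G.IsCycle C → ¬ C ⊆ F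

/-- A spanning tree, as a set of edges. -/
def IsSpanningTree {V E : Type*} (G : OrientedMultigraph V E) (T : Set E) : Prop :=
  G.ConnectsAll T ∧ G.IsSpanningForest T

/-! ### Signatures -/

/-- A cycle signature, given as the finite set of the chosen directed cycles: it contains exactly
one direction of each cycle. -/
def IsCycleSignature {V E : Type*} (G : OrientedMultigraph V E) (σ : Finset (E → ℝ)) : Prop :=
  (∀ c ∈ σ, G.IsDirectedCycle c) ∧
    ∀ C, G.IsCycle C → ∃! c, c ∈ σ ∧ Function.support c = C

/-- A cocycle signature, given as the finite set of the chosen directed cocycles: it contains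
exactly one direction of each cocycle. -/
def IsCocycleSignature {V E : Type*} (G : OrientedMultigraph V E) (τ : Finset (E → ℝ)) : Prop :=
  (∀ d ∈ τ, G.IsDirectedCocycle d) ∧
    ∀ C, G.IsCocycle C → ∃! d, d ∈ τ ∧ Function.support d = C

/-- A signature is acyclic if the only vanishing combination of its elements with nonnegative
coefficients is the trivial one. -/
def IsAcyclic {E : Type*} (σ : Finset (E → ℝ)) : Prop :=
  ∀ a : (E → ℝ) → ℝ, (∀ c ∈ σ, 0 ≤ a c) → ∑ c ∈ σ, a c • c = 0 → ∀ c ∈ σ, a c = 0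

/-! ### Orientations

The reference orientation identifies the orientations with the vectors in `{0,1}^E` (the reference
orientation being `(1, …, 1)`) and the continuous orientations with the points of `[0,1]^E`; in a
continuous orientation an edge is bi-oriented if its coordinate lies in the open interval `(0,1)`. -/

/-- The cube `[0,1]^E` of continuous orientations. -/
def cube (E : Type*) : Set (E → ℝ) := {x | ∀ e, x e ∈ Set.Icc (0 : ℝ) 1}

/-- The set `{0,1}^E` of (discrete) orientations. -/
def orientations (E : Type*) : Set (E → ℝ) := {O | ∀ e, O e = 0 ∨ O e = 1}

/-- The arcs of the `{0, 1, -1}`-vector `c` all belong to the orientation `O`. -/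
def IsIn {E : Type*} (c O : E → ℝ) : Prop :=
  ∀ e, (c e = 1 → O e = 1) ∧ (c e = -1 → O e = 0)

/-- The set of discrete orientations `O` that are `σ`-compatible: any directed cycle in `O` belongs
to `σ`. -/
def compatible {V E : Type*} (G : OrientedMultigraph V E) (σ : Finset (E → ℝ)) : Set (E → ℝ) :=
  {O | O ∈ orientations E ∧ ∀ c, G.IsDirectedCycle c → IsIn c O → c ∈ σ}

/-- The set of discrete orientations `O` that are compatible with the cocycle signature `τ`: any
directed cocycle in `O` belongs to `τ`. -/
def cocompatible {V E : Type*} (G : OrientedMultigraph V E) (τ : Finset (E → ℝ)) : Set (E → ℝ) :=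
  {O | O ∈ orientations E ∧ ∀ d, G.IsDirectedCocycle d → IsIn d O → d ∈ τ}

/-- The set `S_σ` of `σ`-compatible continuous orientations: those which cannot be flowed along any
directed cycle in `σ`. -/
def contCompatible {E : Type*} (σ : Finset (E → ℝ)) : Set (E → ℝ) :=
  {x | x ∈ cube E ∧ ∀ c ∈ σ, ∀ ε : ℝ, 0 < ε → x + ε • c ∉ cube E}

/-! ### The geometric bijection and its extension -/

open Classical in
/-- The orientation `g_{σ,τ}(T)` attached to a spanning tree `T`: an edge `e ∉ T` is oriented as in
the element of `σ` over the fundamental cycle (the unique cycle in `T ∪ {e}`), and an edge `e ∈ T`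
as in the element of `τ` over the fundamental cocycle (the unique cocycle in `(E \ T) ∪ {e}`). -/
noncomputable def treeOrientation {E : Type*} (σ τ : Finset (E → ℝ)) (T : Set E) : E → ℝ :=
  fun e =>
    if e ∈ T then
      if ∃ d ∈ τ, Function.support d ⊆ insert e Tᶜ ∧ d e = 1 then 1 else 0
    else
      if ∃ c ∈ σ, Function.support c ⊆ insert e T ∧ c e = 1 then 1 else 0

/-- `O` is obtained from the `(σ,τ)`-compatible orientation `Ocp = g_{σ,τ}(T)`, `T` a spanning tree,
by reversing the members of a family `𝒞` of directed cycles in `Ocp` and of a family `𝒟` of directed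
cocycles in `Ocp`, all of them disjoint. -/
structure IsReversal {V E : Type*} (G : OrientedMultigraph V E) (σ τ : Finset (E → ℝ))
    (O Ocp : E → ℝ) (T : Set E) (𝒞 𝒟 : Finset (E → ℝ)) : Prop where
  compatible : Ocp ∈ G.compatible σ
  cocompatible : Ocp ∈ G.cocompatible τ
  tree : G.IsSpanningTree T
  tree_eq : treeOrientation σ τ T = Ocp
  cycles : ∀ c ∈ 𝒞, G.IsDirectedCycle c ∧ IsIn c Ocp
  cocycles : ∀ d ∈ 𝒟, G.IsDirectedCocycle d ∧ IsIn d Ocp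
  disjoint_cycles : (𝒞 : Set (E → ℝ)).PairwiseDisjoint Function.support
  disjoint_cocycles : (𝒟 : Set (E → ℝ)).PairwiseDisjoint Function.support
  disjoint_cycle_cocycle : ∀ c ∈ 𝒞, ∀ d ∈ 𝒟,
    Disjoint (Function.support c) (Function.support d)
  reversed : O = Ocp - ∑ c ∈ 𝒞, c - ∑ d ∈ 𝒟, d

/-- The spanning subgraph `T ∪ (⋃ C_i) \ (⋃ C_j^*)`. -/
def modifiedTree {E : Type*} (T : Set E) (𝒞 𝒟 : Finset (E → ℝ)) : Set E :=
  (T ∪ ⋃ c ∈ 𝒞, Function.support c) \ ⋃ d ∈ 𝒟, Function.support d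

open Classical in
/-- The map `φ_{σ,τ}` from orientations to spanning subgraphs: if `O` is obtained by reversing
disjoint directed cycles `𝒞` and cocycles `𝒟` in the `(σ,τ)`-compatible orientation `g_{σ,τ}(T)`,
then its value at `O` is `T ∪ (⋃ C_i) \ (⋃ C_j^*)`. -/
noncomputable def phi {V E : Type*} (G : OrientedMultigraph V E) (σ τ : Finset (E → ℝ))
    (O : E → ℝ) : Set E :=
  if h : ∃ S, ∃ Ocp T 𝒞 𝒟, G.IsReversal σ τ O Ocp T 𝒞 𝒟 ∧ S = modifiedTree T 𝒞 𝒟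
  then h.choose else ∅

/-! ### Half-open cells -/

/-- `H` is a standard half-open cell in `ℝ^E` with lattice point `a` and generating set `S`: a
product of intervals `I e`, where `I e` is `{a e}` for `e ∉ S`, and `(a e - 1, a e]` or
`[a e, a e + 1)` for `e ∈ S`. -/
def IsStandardHalfOpenCell {E : Type*} (H : Set (E → ℝ)) (a : E → ℝ) (S : Set E) : Prop :=
  (∀ e, ∃ k : ℤ, a e = k) ∧ ∃ I : E → Set ℝ, H = Set.univ.pi I ∧
    ∀ e, (e ∉ S → I e = {a e}) ∧
      (e ∈ S → I e = Set.Ioc (a e - 1) (a e) ∨ I e = Set.Ico (a e) (a e + 1))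

/-- The cell `hoc(O,S)`: the continuous orientations in which each edge `e ∉ S` is oriented
according to `O` and each edge `e ∈ S` is oriented according to `O` or bi-oriented. -/
def hoc {E : Type*} (O : E → ℝ) (S : Set E) : Set (E → ℝ) :=
  {x | x ∈ cube E ∧ (∀ e, e ∉ S → x e = O e) ∧
    ∀ e, e ∈ S → x e = O e ∨ x e ∈ Set.Ioo (0 : ℝ) 1}

end OrientedMultigraph

/-! ### A linear description of signatures on orthogonal subspaces -/

namespace OrientedMultigraph

open scoped Matrix

variable {E : Type*} [Fintype E]

/-! Flows and cuts form orthogonal spaces `L` and `M`. Acyclicity lets linear functionals `w`, `w'`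
be chosen that are positive on the signatures (`IsAcyclic.exists_pos`). A spanning tree is a common
basis `T`. Its orientation is read off from the vector of `w' + L` supported in `T` and the vector
of `w + M` supported off `T`: their signs give the directions of all edges (`IsCertificate`). Linear
programming duality shows that every orientation compatible on both sides arises in this way
(`exists_certificate_of_orientedBy`). Maximising `w`, then `w'`, over orientations in a class modulo
`L`, then `M`, writes any orientation as such a `P` minus a flow `K` and a cut vector `D` with
disjoint supports.

The central fact is `IsVectorReversal.eq_of_agree`: if two orientations agree wherever exactly one
of their attached sets contains the edge, then all their data coincide. Its proof only uses
orthogonality and the signs of the certificates. It makes `phi` independent of choices, makes `phi`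
injective, and makes the cells disjoint. The rest of the tiling is counting: an injective map
between finite sets of equal size is onto, which gives all edge sets as images and lets the cells
cover the cube.

Compatibility with `σ` means `K = 0`. Then the attached set lies in a tree, and no chosen cycle can
be added to a point of the cell. If `K ≠ 0`, the attached set contains a chosen cycle along which
every point of the cell can flow. This separates the cells inside `S_σ` from those outside, and
forests from the other edge sets. -/

/-- `L` is the orthogonal complement of `M`, every nonzero vector of `L` has a conformal
`{0, 1, -1}`-vector in `X ⊆ L`, and `σ` contains for every `c ∈ X` the one of `c`, `-c` on which `w`
is positive. -/
structure SignedSpace (L M : Submodule ℝ (E → ℝ)) (X : Set (E → ℝ)) (σ : Finset (E → ℝ))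
    (w : E → ℝ) : Prop where
  orth : ∀ z, z ∈ L ↔ ∀ y ∈ M, z ⬝ᵥ y = 0
  mem : ∀ c ∈ X, c ∈ L
  ne_zero : ∀ c ∈ X, c ≠ 0
  values : ∀ c ∈ X, ∀ e, c e = 0 ∨ c e = 1 ∨ c e = -1
  conformal : ∀ z ∈ L, z ≠ 0 → ∃ c ∈ X, ∀ e, c e ≠ 0 → 0 < c e * z e
  neg_mem : ∀ c ∈ X, -c ∈ X
  sig_mem : ∀ c ∈ σ, c ∈ X
  sig_or : ∀ c ∈ X, c ∈ σ ∨ -c ∈ σ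
  pos : ∀ c ∈ σ, 0 < w ⬝ᵥ c

/-- A pair of orthogonal signed spaces. -/
structure SignedDuality (L M : Submodule ℝ (E → ℝ)) (X Y : Set (E → ℝ)) (σ τ : Finset (E → ℝ))
    (w w' : E → ℝ) : Prop where
  left : SignedSpace L M X σ w
  right : SignedSpace M L Y τ w'

/-- `T` is a basis: `L` has no nonzero vector supported in `T`, and `M` none supported off `T`. -/
structure IsBasis (L M : Submodule ℝ (E → ℝ)) (T : Set E) : Prop where
  left : ∀ z ∈ L, (∀ e, e ∉ T → z e = 0) → z = 0
  right : ∀ y ∈ M, (∀ e, e ∈ T → y e = 0) → y = 0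

/-- `u` and `v` witness that the orientation `O` belongs to the basis `T`. -/
structure IsCertificate (L M : Submodule ℝ (E → ℝ)) (w w' : E → ℝ) (O : E → ℝ) (T : Set E)
    (u v : E → ℝ) : Prop where
  u_mem : u - w' ∈ L
  v_mem : v - w ∈ M
  u_zero : ∀ e, e ∉ T → u e = 0
  v_zero : ∀ e, e ∈ T → v e = 0
  u_sign : ∀ e, e ∈ T → 0 < (2 * O e - 1) * u e
  v_sign : ∀ e, e ∉ T → 0 < (2 * O e - 1) * v e

/-- The set `X` of directed vectors is oriented by `σ` in `O`. -/
def OrientedBy (X : Set (E → ℝ)) (σ : Finset (E → ℝ)) (O : E → ℝ) : Prop :=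
  ∀ c ∈ X, IsIn c O → c ∈ σ

variable {L M : Submodule ℝ (E → ℝ)} {X Y : Set (E → ℝ)} {σ τ : Finset (E → ℝ)} {w w' : E → ℝ}

omit [Fintype E] in
theorem two_mul_sub_one {O : E → ℝ} (hO : O ∈ orientations E) (e : E) :
    2 * O e - 1 = 1 ∨ 2 * O e - 1 = -1 := by
  rcases hO e with h | h <;> rw [h] <;> norm_num

omit [Fintype E] in
theorem isIn_of_nonneg {c O : E → ℝ} (hO : O ∈ orientations E)
    (h : ∀ e, 0 ≤ (2 * O e - 1) * c e) : IsIn c O := by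
  intro e
  have := h e
  rcases hO e with h0 | h0 <;> rw [h0] at this ⊢ <;> constructor <;> intro h1 <;>
    rw [h1] at this <;> norm_num at *

omit [Fintype E] in
theorem IsIn.nonneg {c O : E → ℝ} (hc : ∀ e, c e = 0 ∨ c e = 1 ∨ c e = -1) (h : IsIn c O) (e : E) :
    0 ≤ (2 * O e - 1) * c e := by
  rcases hc e with h0 | h0 | h0
  · simp [h0]
  · rw [h0, (h e).1 h0]; norm_num
  · rw [h0, (h e).2 h0]; norm_num

theorem exists_dotProduct_eq (f : (E → ℝ) →ₗ[ℝ] ℝ) : ∃ y : E → ℝ, ∀ x, f x = x ⬝ᵥ y := by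
  classical
  refine ⟨fun e => f (Pi.single e 1), fun x => ?_⟩
  rw [f.pi_apply_eq_sum_univ x]
  simp only [smul_eq_mul, dotProduct]
  congr! with e _ j
  simp [Pi.single_apply, eq_comm]

/-- The roles of flows and cuts are symmetric, with `T` replaced by its complement. Results for
cycles therefore transfer to cocycles. -/
theorem SignedDuality.symm (H : SignedDuality L M X Y σ τ w w') :
    SignedDuality M L Y X τ σ w' w := ⟨H.right, H.left⟩

omit [Fintype E] in
theorem IsBasis.symm {T : Set E} (h : IsBasis L M T) : IsBasis M L Tᶜ :=
  ⟨fun y hy h0 => h.right y hy fun e he => h0 e (by simpa using he),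
    fun z hz h0 => h.left z hz fun e he => h0 e he⟩

omit [Fintype E] in
theorem IsCertificate.symm {O u v : E → ℝ} {T : Set E} (h : IsCertificate L M w w' O T u v) :
    IsCertificate M L w' w O Tᶜ v u :=
  ⟨h.v_mem, h.u_mem, fun e he => h.v_zero e (by simpa using he), fun e he => h.u_zero e he,
    fun e he => h.v_sign e he, fun e he => h.u_sign e (by simpa using he)⟩

/-! ### Conformal decomposition and fundamental vectors. -/

namespace SignedSpace

theorem dot_eq_zero (H : SignedSpace L M X σ w) {z y : E → ℝ} (hz : z ∈ L) (hy : y ∈ M) :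
    z ⬝ᵥ y = 0 := (H.orth z).1 hz y hy

/-- Against `L`, the functional `w` may be replaced by any representative modulo `M`; one that
vanishes on a basis carries the sign information. -/
theorem dot_congr (H : SignedSpace L M X σ w) {z v : E → ℝ} (hz : z ∈ L) (hv : v - w ∈ M) :
    v ⬝ᵥ z = w ⬝ᵥ z := by
  have := H.dot_eq_zero hz hv
  rw [dotProduct_sub, sub_eq_zero] at this
  rw [dotProduct_comm, this, dotProduct_comm]

theorem dot_ne_zero (H : SignedSpace L M X σ w) {c : E → ℝ} (hc : c ∈ X) : w ⬝ᵥ c ≠ 0 := by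
  rcases H.sig_or c hc with h | h
  · exact (H.pos c h).ne'
  · have := H.pos _ h
    rw [dotProduct_neg] at this
    linarith

theorem mem_of_dot_pos (H : SignedSpace L M X σ w) {c : E → ℝ} (hc : c ∈ X) (h : 0 < w ⬝ᵥ c) :
    c ∈ σ := by
  rcases H.sig_or c hc with h1 | h1
  · exact h1
  · have := H.pos _ h1
    rw [dotProduct_neg] at this
    linarith

theorem neg_notMem (H : SignedSpace L M X σ w) {c : E → ℝ} (hc : c ∈ σ) : -c ∉ σ := by
  intro h
  have h1 := H.pos _ h
  have h2 := H.pos _ hc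
  rw [dotProduct_neg] at h1
  linarith

omit [Fintype E] in
theorem sign_eq {a b : ℝ} (ha : a = 0 ∨ a = 1 ∨ a = -1) (hb : b = 0 ∨ b = 1 ∨ b = -1)
    (h : 0 < a * b) : a = b := by
  rcases ha with rfl | rfl | rfl <;> rcases hb with rfl | rfl | rfl <;> norm_num at *

/-- A conformal vector agrees with `K` on its support because both have values in `{0, 1, -1}`.
Subtracting it erases exactly that support, so induction on the support size applies. -/
theorem exists_sum_disjoint (H : SignedSpace L M X σ w) (n : ℕ) :
    ∀ K ∈ L, (∀ e, K e = 0 ∨ K e = 1 ∨ K e = -1) → (Function.support K).ncard = n →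
      ∃ 𝒞 : Finset (E → ℝ), (∀ c ∈ 𝒞, c ∈ X ∧ ∀ e, c e ≠ 0 → c e = K e) ∧
        (𝒞 : Set (E → ℝ)).PairwiseDisjoint Function.support ∧ ∑ c ∈ 𝒞, c = K := by
  classical
  induction n using Nat.strong_induction_on with
  | _ n ih =>
    intro K hK hv hn
    by_cases h0 : K = 0
    · exact ⟨∅, by simp, by simp, by simp [h0]⟩
    obtain ⟨c, hc, hcK⟩ := H.conformal K hK h0
    have hce : ∀ e, c e ≠ 0 → c e = K e := fun e he =>
      sign_eq (H.values c hc e) (hv e) (hcK e he)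
    obtain ⟨e₀, he₀⟩ := Function.ne_iff.1 (H.ne_zero c hc)
    have hsub : ∀ e, (K - c) e = 0 ∨ ((K - c) e = K e ∧ c e = 0) := by
      intro e
      by_cases h : c e = 0
      · right; simp [h]
      · left; simp [hce e h]
    have hlt : (Function.support (K - c)).ncard < n := by
      rw [← hn]
      refine Set.ncard_lt_ncard ⟨?_, ?_⟩ (Set.toFinite _)
      · intro e he
        rcases hsub e with h | h
        · exact absurd h he
        · rw [Function.mem_support] at he ⊢
          rwa [h.1] at he
      · intro h
        have h1 : e₀ ∈ Function.support K := by
          rw [Function.mem_support, ← hce e₀ he₀]; exact he₀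
        have h2 := h h1
        rcases hsub e₀ with h3 | h3
        · exact h2 h3
        · exact he₀ h3.2
    obtain ⟨𝒞, h1, h2, h3⟩ := ih _ hlt (K - c) (L.sub_mem hK (H.mem c hc))
      (fun e => by
        rcases hsub e with h | h
        · exact Or.inl h
        · rw [h.1]; exact hv e) rfl
    have h4 : ∀ c' ∈ 𝒞, ∀ e, c' e ≠ 0 → c e = 0 ∧ c' e = K e := by
      intro c' hc' e he
      have h5 := (h1 c' hc').2 e he
      rcases hsub e with h | h
      · rw [h] at h5; exact absurd h5 he
      · exact ⟨h.2, h5.trans h.1⟩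
    have hnot : c ∉ 𝒞 := fun h => he₀ (h4 c h e₀ he₀).1
    refine ⟨insert c 𝒞, ?_, ?_, ?_⟩
    · intro c' hc'
      rcases Finset.mem_insert.1 hc' with rfl | h
      · exact ⟨hc, hce⟩
      · exact ⟨(h1 c' h).1, fun e he => (h4 c' h e he).2⟩
    · rw [Finset.coe_insert]
      refine h2.insert fun c' hc' _ => ?_
      rw [Set.disjoint_left]
      intro e he he'
      exact he (h4 c' hc' e he').1
    · rw [Finset.sum_insert hnot, h3]; abel

/-- If `O` is oriented by `σ`, then `w` is positive on the vectors of `L` that agree with `O`. -/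
theorem dot_pos_of_orientedBy (H : SignedSpace L M X σ w) {O : E → ℝ} (hO : O ∈ orientations E)
    (hc : OrientedBy X σ O) (n : ℕ) :
    ∀ z ∈ L, z ≠ 0 → (∀ e, 0 ≤ (2 * O e - 1) * z e) → (Function.support z).ncard = n →
      0 < w ⬝ᵥ z := by
  classical
  induction n using Nat.strong_induction_on with
  | _ n ih =>
    intro z hz hz0 hpos hn
    obtain ⟨c, hcX, hcz⟩ := H.conformal z hz hz0
    obtain ⟨e₁, he₁⟩ := Function.ne_iff.1 (H.ne_zero c hcX)
    have hne : (Finset.univ.filter fun e => c e ≠ 0).Nonempty := ⟨e₁, by simpa using he₁⟩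
    obtain ⟨e₀, he₀, hmin⟩ := Finset.exists_min_image _ (fun e => z e / c e) hne
    simp only [Finset.mem_filter, Finset.mem_univ, true_and] at he₀ hmin
    -- The smallest ratio is the largest multiple of `c` that can be subtracted without leaving the
    -- orthant; it kills the coordinate `e₀`.
    set t := z e₀ / c e₀ with ht
    have htpos : 0 < t := by
      have := hcz e₀ he₀
      rw [ht]
      rcases mul_pos_iff.1 this with h | h
      · exact div_pos h.2 h.1
      · exact div_pos_of_neg_of_neg h.2 h.1
    have hsq : ∀ e, c e ≠ 0 → c e * c e = 1 := by
      intro e he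
      rcases H.values c hcX e with h | h | h
      · exact absurd h he
      · rw [h]; norm_num
      · rw [h]; norm_num
    have hcpos : ∀ e, 0 ≤ (2 * O e - 1) * c e := by
      intro e
      by_cases h : c e = 0
      · simp [h]
      have h1 := hpos e
      have h2 := hcz e h
      have h3 : (2 * O e - 1) * z e * (c e * z e) = (2 * O e - 1) * c e * (z e * z e) := by ring
      have h4 : 0 < z e * z e := by
        apply mul_self_pos.2
        rintro h5
        simp [h5] at h2
      by_contra h5
      push Not at h5
      nlinarith [mul_nonneg h1 h2.le]
    have hcσ : c ∈ σ := hc c hcX (isIn_of_nonneg hO hcpos)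
    have hwc := H.pos c hcσ
    have hle : ∀ e, c e ≠ 0 → t ≤ z e * c e := by
      intro e he
      have h1 := hmin e he
      have h2 : z e / c e = z e * c e := by
        rw [div_eq_iff he, mul_assoc, hsq e he, mul_one]
      rwa [h2] at h1
    set z' := z - t • c with hz'
    have hz'e : ∀ e, z' e = z e - t * c e := fun e => by simp [hz']
    have hz'L : z' ∈ L := L.sub_mem hz (L.smul_mem _ (H.mem c hcX))
    have hzz : w ⬝ᵥ z = w ⬝ᵥ z' + t * (w ⬝ᵥ c) := by
      rw [hz', dotProduct_sub, dotProduct_smul, smul_eq_mul]; ring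
    rw [hzz]
    by_cases h0 : z' = 0
    · rw [h0, dotProduct_zero, zero_add]; positivity
    have hlt : (Function.support z').ncard < n := by
      rw [← hn]
      refine Set.ncard_lt_ncard ⟨?_, ?_⟩ (Set.toFinite _)
      · intro e he he'
        apply he
        have : c e = 0 := by
          by_contra h
          have := hcz e h
          simp [he'] at this
        simp [hz'e, he', this]
      · intro h
        have h1 : e₀ ∈ Function.support z := by
          intro h2
          have := hcz e₀ he₀
          simp [h2] at this
        apply h h1
        rw [hz'e, ht]
        field_simp
        ring
    have := ih _ hlt z' hz'L h0 (fun e => by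
      by_cases h : c e = 0
      · simpa [hz'e, h] using hpos e
      have h1 := hle e h
      have h2 := hcpos e
      have h3 : z' e = (z e * c e - t) * c e := by
        rw [hz'e, sub_mul, mul_assoc, hsq e h, mul_one]
      rw [h3]
      have : (2 * O e - 1) * ((z e * c e - t) * c e) = (z e * c e - t) * ((2 * O e - 1) * c e) := by
        ring
      rw [this]
      exact mul_nonneg (by linarith) h2) rfl
    have := mul_pos htpos hwc
    linarith

/-- The values off a basis of a vector in `L` can be prescribed. -/
theorem exists_extension (H : SignedSpace M L Y τ w') {T : Set E}
    (hT : IsBasis L M T) (r : E → ℝ) : ∃ z ∈ L, ∀ e, e ∉ T → z e = r e := by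
  classical
  let N : Submodule ℝ (E → ℝ) :=
    { carrier := {x | ∀ e, e ∉ T → x e = 0}
      add_mem' := fun {a b} ha hb e he => by simp [ha e he, hb e he]
      zero_mem' := fun e _ => rfl
      smul_mem' := fun k a ha e he => by simp [ha e he] }
  -- Otherwise a nonzero functional kills `L` and `N`; it is represented by a vector of `M`
  -- vanishing on `T`.
  have htop : L ⊔ N = ⊤ := by
    by_contra hne
    obtain ⟨f, hf0, hf⟩ := Submodule.exists_le_ker_of_lt_top (L ⊔ N) (lt_top_iff_ne_top.2 hne)
    obtain ⟨y, hfy⟩ := exists_dotProduct_eq f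
    have hyM : y ∈ M := by
      rw [H.orth]
      intro z hz
      rw [dotProduct_comm, ← hfy]
      exact hf (Submodule.mem_sup_left hz)
    have : y = 0 := hT.right y hyM fun e he => by
      have : (Pi.single e 1 : E → ℝ) ∈ N := by
        intro e' he'
        have : e' ≠ e := fun h => he' (h ▸ he)
        simp [this]
      have h1 : f (Pi.single e 1) = 0 := hf (Submodule.mem_sup_right this)
      simpa [hfy] using h1
    exact hf0 (LinearMap.ext fun x => by rw [hfy, this, dotProduct_zero, LinearMap.zero_apply])
  have hr : r ∈ L ⊔ N := htop ▸ Submodule.mem_top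
  obtain ⟨z, hz, n, hn, rfl⟩ := Submodule.mem_sup.1 hr
  exact ⟨z, hz, fun e he => by simp [hn e he]⟩

/-- The fundamental vector of `e ∉ T`. -/
theorem exists_fundamental (H : SignedSpace L M X σ w) (H' : SignedSpace M L Y τ w') {T : Set E}
    (hT : IsBasis L M T) {e : E} (he : e ∉ T) :
    ∃ c ∈ σ, Function.support c ⊆ insert e T ∧ c e ≠ 0 := by
  classical
  obtain ⟨z, hz, hze⟩ := H'.exists_extension hT (Pi.single e 1)
  have hz0 : z ≠ 0 := by
    rintro rfl
    simpa using hze e he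
  obtain ⟨c, hc, hcz⟩ := H.conformal z hz hz0
  have hs : Function.support c ⊆ insert e T := by
    intro f hf
    by_contra h
    simp only [Set.mem_insert_iff, not_or] at h
    have h1 := hcz f hf
    rw [hze f h.2] at h1
    simp [h.1] at h1
  have hce : c e ≠ 0 := by
    intro h
    apply H.ne_zero c hc
    apply hT.left c (H.mem c hc)
    intro f hf
    by_contra h1
    rcases hs h1 with rfl | h2
    · exact h1 h
    · exact hf h2
  rcases H.sig_or c hc with h | h
  · exact ⟨c, h, hs, hce⟩
  · exact ⟨-c, h, by simpa using hs, by simpa using hce⟩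

/-- A vector vanishing on `T` only sees the fundamental edge. -/
theorem dot_fundamental {T : Set E} {v c : E → ℝ} {e : E}
    (hv : ∀ f, f ∈ T → v f = 0) (hs : Function.support c ⊆ insert e T) :
    v ⬝ᵥ c = v e * c e := by
  classical
  rw [dotProduct, Finset.sum_eq_single e]
  · intro f _ hf
    by_cases h : c f = 0
    · simp [h]
    · rcases hs h with h1 | h1
      · exact absurd h1 hf
      · simp [hv f h1]
  · simp

/-- Pairing `v` with a chosen `c` supported in `insert e T` leaves the single term `v e * c e`,
which equals `w ⬝ᵥ c > 0`. So `v e` has the sign of the fundamental vector at `e`. -/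
theorem pos_iff_exists_fundamental (H : SignedSpace L M X σ w) (H' : SignedSpace M L Y τ w')
    {T : Set E} (hT : IsBasis L M T) {v : E → ℝ} (hv : v - w ∈ M) (hv0 : ∀ f, f ∈ T → v f = 0)
    {e : E} (he : e ∉ T) :
    v e ≠ 0 ∧ (0 < v e ↔ ∃ c ∈ σ, Function.support c ⊆ insert e T ∧ c e = 1) := by
  have key : ∀ c ∈ σ, Function.support c ⊆ insert e T → 0 < v e * c e := by
    intro c hc hs
    rw [← dot_fundamental hv0 hs, H.dot_congr (H.mem c (H.sig_mem c hc)) hv]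
    exact H.pos c hc
  obtain ⟨c, hc, hs, hce⟩ := H.exists_fundamental H' hT he
  have h := key c hc hs
  refine ⟨fun h0 => by simp [h0] at h, fun h0 => ⟨c, hc, hs, ?_⟩, ?_⟩
  · rcases H.values c (H.sig_mem c hc) e with h1 | h1 | h1
    · exact absurd h1 hce
    · exact h1
    · rw [h1] at h; linarith
  · rintro ⟨c', hc', hs', h1⟩
    have := key c' hc' hs'
    rwa [h1, mul_one] at this

/-- The vector of `w + M` vanishing on a basis. -/
theorem exists_reduced (H : SignedSpace L M X σ w) {T : Set E} (hT : IsBasis L M T) : ∃ v, v - w ∈ M ∧ ∀ f, f ∈ T → v f = 0 := by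
  obtain ⟨y, hy, hye⟩ := H.exists_extension hT.symm w
  refine ⟨w - y, ?_, fun f hf => ?_⟩
  · rw [sub_sub_cancel_left]; exact M.neg_mem hy
  · simp [hye f (by simpa using hf)]

end SignedSpace

end OrientedMultigraph

namespace OrientedMultigraph

open scoped Matrix

variable {E : Type*} [Fintype E] {L M : Submodule ℝ (E → ℝ)} {X Y : Set (E → ℝ)}
  {σ τ : Finset (E → ℝ)} {w w' : E → ℝ}

/-! ### Certificates -/

omit [Fintype E] in
theorem treeOrientation_mem (T : Set E) : treeOrientation σ τ T ∈ orientations E := by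
  intro e
  unfold treeOrientation
  split_ifs <;> simp

namespace SignedDuality

/-- The orientation of a basis has a certificate. -/
theorem exists_certificate (H : SignedDuality L M X Y σ τ w w') {T : Set E}
    (hT : IsBasis L M T) : ∃ u v, IsCertificate L M w w' (treeOrientation σ τ T) T u v := by
  obtain ⟨v, hv, hv0⟩ := H.left.exists_reduced hT
  obtain ⟨u, hu, hu0⟩ := H.right.exists_reduced hT.symm
  refine ⟨u, v, hu, hv, fun e he => hu0 e he, hv0, fun e he => ?_, fun e he => ?_⟩
  · obtain ⟨h1, h2⟩ := H.right.pos_iff_exists_fundamental H.left hT.symm hu hu0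
      (e := e) (by simpa using he)
    unfold treeOrientation
    rw [if_pos he]
    split_ifs with h
    · have := h2.2 h
      linarith
    · have := lt_of_le_of_ne (not_lt.1 fun h3 => h (h2.1 h3)) h1
      linarith
  · obtain ⟨h1, h2⟩ := H.left.pos_iff_exists_fundamental H.right hT hv hv0 he
    unfold treeOrientation
    rw [if_neg he]
    split_ifs with h
    · have := h2.2 h
      linarith
    · have := lt_of_le_of_ne (not_lt.1 fun h3 => h (h2.1 h3)) h1
      linarith

end SignedDuality

omit [Fintype E] in
theorem eq_of_mul_pos {O O' : E → ℝ} (hO : O ∈ orientations E) (hO' : O' ∈ orientations E)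
    {e : E} {a : ℝ} (h : 0 < (2 * O e - 1) * a) (h' : 0 < (2 * O' e - 1) * a) : O e = O' e := by
  rcases hO e with h1 | h1 <;> rcases hO' e with h2 | h2 <;> rw [h1] at h ⊢ <;>
    rw [h2] at h' ⊢ <;> linarith

/-- An orientation with a certificate is the orientation of its basis. -/
theorem IsCertificate.eq_treeOrientation (H : SignedDuality L M X Y σ τ w w') {T : Set E}
    (hT : IsBasis L M T) {O u v : E → ℝ} (hO : O ∈ orientations E)
    (h : IsCertificate L M w w' O T u v) : treeOrientation σ τ T = O := by
  obtain ⟨u', v', h'⟩ := H.exists_certificate hT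
  -- A basis has at most one certificate pair: the difference of the `u`'s lies in `L` and is
  -- supported in `T`, and dually for `v`.
  have hu : u' - u = 0 := hT.left _ (by
    have := L.sub_mem h'.u_mem h.u_mem
    rwa [sub_sub_sub_cancel_right] at this) fun e he => by
      simp [h.u_zero e he, h'.u_zero e he]
  have hv : v' - v = 0 := hT.right _ (by
    have := M.sub_mem h'.v_mem h.v_mem
    rwa [sub_sub_sub_cancel_right] at this) fun e he => by
      simp [h.v_zero e he, h'.v_zero e he]
  rw [sub_eq_zero] at hu hv
  subst hu hv
  ext e
  by_cases he : e ∈ T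
  · exact eq_of_mul_pos (treeOrientation_mem T) hO (h'.u_sign e he) (h.u_sign e he)
  · exact eq_of_mul_pos (treeOrientation_mem T) hO (h'.v_sign e he) (h.v_sign e he)

/-- An orientation with a certificate is compatible. -/
theorem IsCertificate.orientedBy (H : SignedDuality L M X Y σ τ w w') {T : Set E}
    (hT : IsBasis L M T) {O u v : E → ℝ} (h : IsCertificate L M w w' O T u v) :
    OrientedBy X σ O := by
  intro c hc hcO
  apply H.left.mem_of_dot_pos hc
  -- With `v` in place of `w` every term is nonnegative: `v` vanishes on `T`, and off `T` both `v`
  -- and `c` follow `O`.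
  rw [← H.left.dot_congr (H.left.mem c hc) h.v_mem, dotProduct]
  have hpos : ∀ e, 0 ≤ v e * c e ∧ (e ∉ T → c e ≠ 0 → 0 < v e * c e) := by
    intro e
    by_cases he : e ∈ T
    · simp [h.v_zero e he, he]
    have h1 := h.v_sign e he
    rcases H.left.values c hc e with h0 | h0 | h0
    · simp [h0]
    · have := (hcO e).1 h0
      rw [this] at h1
      have : 0 < v e * c e := by rw [h0]; linarith
      exact ⟨this.le, fun _ _ => this⟩
    · have := (hcO e).2 h0
      rw [this] at h1
      have : 0 < v e * c e := by rw [h0]; linarith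
      exact ⟨this.le, fun _ _ => this⟩
  have hex : ∃ e, e ∉ T ∧ c e ≠ 0 := by
    by_contra hno
    push Not at hno
    exact H.left.ne_zero c hc (hT.left c (H.left.mem c hc) hno)
  obtain ⟨e, he, hce⟩ := hex
  exact Finset.sum_pos' (fun e _ => (hpos e).1) ⟨e, Finset.mem_univ e, (hpos e).2 he hce⟩

/-- Two certified orientations that agree on the symmetric difference of their bases have the same
basis. -/
theorem IsCertificate.basis_eq (H : SignedDuality L M X Y σ τ w w') {T₁ T₂ : Set E}
    {O₁ u₁ v₁ O₂ u₂ v₂ : E → ℝ} (hO₁ : O₁ ∈ orientations E)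
    (h₁ : IsCertificate L M w w' O₁ T₁ u₁ v₁) (h₂ : IsCertificate L M w w' O₂ T₂ u₂ v₂)
    (hagree : ∀ e, (e ∈ T₁ ↔ e ∈ T₂) ∨ O₁ e = O₂ e) : T₁ = T₂ := by
  have hu : u₁ - u₂ ∈ L := by
    have := L.sub_mem h₁.u_mem h₂.u_mem
    rwa [sub_sub_sub_cancel_right] at this
  have hv : v₁ - v₂ ∈ M := by
    have := M.sub_mem h₁.v_mem h₂.v_mem
    rwa [sub_sub_sub_cancel_right] at this
  -- The product is strictly negative where exactly one basis contains `e`, and zero elsewhere.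
  -- Orthogonality makes the sum vanish.
  have hpos : ∀ e, (u₁ - u₂) e * (v₁ - v₂) e ≤ 0 ∧
      ((u₁ - u₂) e * (v₁ - v₂) e = 0 → (e ∈ T₁ ↔ e ∈ T₂)) := by
    intro e
    have hs : ∀ a b : ℝ, 0 < (2 * O₁ e - 1) * a → 0 < (2 * O₁ e - 1) * b → 0 < a * b := by
      intro a b ha hb
      rcases hO₁ e with h | h <;> rw [h] at ha hb <;> nlinarith
    by_cases e1 : e ∈ T₁ <;> by_cases e2 : e ∈ T₂
    · simp [h₁.v_zero e e1, h₂.v_zero e e2, e1, e2]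
    · have ho : O₁ e = O₂ e := by simpa [e1, e2] using hagree e
      have := hs _ _ (h₁.u_sign e e1) (ho ▸ h₂.v_sign e e2)
      simp only [Pi.sub_apply, h₁.v_zero e e1, h₂.u_zero e e2]
      constructor
      · linarith
      · intro h; linarith
    · have ho : O₁ e = O₂ e := by simpa [e1, e2] using hagree e
      have := hs _ _ (h₁.v_sign e e1) (ho ▸ h₂.u_sign e e2)
      simp only [Pi.sub_apply, h₁.u_zero e e1, h₂.v_zero e e2]
      constructor
      · linarith
      · intro h; linarith
    · simp [h₁.u_zero e e1, h₂.u_zero e e2, e1, e2]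
  have h0 := H.left.dot_eq_zero hu hv
  rw [dotProduct, Finset.sum_eq_zero_iff_of_nonpos fun e _ => (hpos e).1] at h0
  ext e
  exact (hpos e).2 (h0 e (Finset.mem_univ e))

/-! ### Every compatible orientation has a certificate -/

namespace SignedSpace

/-- If `O` is oriented by `τ`, then some vector of `w' + L` lies in the open orthant of `O`. -/
theorem exists_mem_orthant (H : SignedSpace M L Y τ w') {O : E → ℝ} (hO : O ∈ orientations E)
    (hτ : OrientedBy Y τ O) : ∃ u, u - w' ∈ L ∧ ∀ e, 0 < (2 * O e - 1) * u e := by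
  by_contra hno
  push Not at hno
  have hsq : ∀ e, (2 * O e - 1) * (2 * O e - 1) = 1 := by
    intro e
    rcases two_mul_sub_one hO e with h | h <;> rw [h] <;> norm_num
  have hopen : IsOpen {x : E → ℝ | ∀ e, 0 < (2 * O e - 1) * x e} := by
    simp only [Set.ofPred_forall]
    exact isOpen_iInter_of_finite fun e => isOpen_lt continuous_const (by fun_prop)
  have hconv : Convex ℝ {x : E → ℝ | ∀ e, 0 < (2 * O e - 1) * x e} := by
    intro x hx y hy a b ha hb hab e
    have h1 := hx e
    have h2 := hy e
    simp only [Pi.add_apply, Pi.smul_apply, smul_eq_mul]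
    have : (2 * O e - 1) * (a * x e + b * y e) =
      a * ((2 * O e - 1) * x e) + b * ((2 * O e - 1) * y e) := by ring
    rw [this]
    rcases ha.lt_or_eq with h | h
    · have := mul_pos h h1
      have := mul_nonneg hb h2.le
      linarith
    · have : b = 1 := by linarith
      rw [← h, this]; linarith
  have hconv' : Convex ℝ {x : E → ℝ | x - w' ∈ L} := by
    intro x hx y hy a b ha hb hab
    have : a • x + b • y - w' = a • (x - w') + b • (y - w') := by
      have hw : w' = a • w' + b • w' := by rw [← add_smul, hab, one_smul]
      conv_lhs => rw [hw]
      rw [smul_sub, smul_sub]; abel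
    rw [Set.mem_ofPred_eq, this]
    exact L.add_mem (L.smul_mem _ hx) (L.smul_mem _ hy)
  have hdisj : Disjoint {x : E → ℝ | ∀ e, 0 < (2 * O e - 1) * x e} {x : E → ℝ | x - w' ∈ L} := by
    rw [Set.disjoint_left]
    intro x hx hx'
    obtain ⟨e, he⟩ := hno x hx'
    exact absurd (hx e) (not_lt.2 he)
  -- A separating functional is bounded below on `w' + L`, so it kills `L` and is given by some `y ∈
  -- M`. The vector `-y` lies in the closed orthant, so compatibility gives `w' ⬝ᵥ (-y) > 0`,
  -- against `0 ≤ s ≤ f w'`.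
  obtain ⟨f, s, hf1, hf2⟩ := geometric_hahn_banach_open hconv hopen hconv' hdisj
  obtain ⟨y, hy⟩ := exists_dotProduct_eq f.toLinearMap
  have hfy : ∀ x, f x = x ⬝ᵥ y := hy
  have hfL : ∀ z ∈ L, f z = 0 := by
    intro z hz
    by_contra h
    -- The multiple is chosen so that `f` takes the value `s - 1`.
    have := hf2 (w' + ((s - 1 - f w') / f z) • z) (by
      simpa using L.smul_mem _ hz)
    rw [map_add, map_smul, smul_eq_mul, div_mul_cancel₀ _ h] at this
    linarith
  have hyM : -y ∈ M := by
    refine M.neg_mem ((H.orth y).2 fun z hz => ?_)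
    rw [dotProduct_comm, ← hfy, hfL z hz]
  have hone : ∀ r : ℝ, 0 < r → f (r • fun e => 2 * O e - 1) < s := fun r hr => hf1 _ fun e => by
    simp only [Pi.smul_apply, smul_eq_mul]
    have : (2 * O e - 1) * (r * (2 * O e - 1)) = r * ((2 * O e - 1) * (2 * O e - 1)) := by ring
    rw [this, hsq e, mul_one]
    exact hr
  have hs : 0 ≤ s := by
    by_contra hs
    push Not at hs
    set q := f fun e => 2 * O e - 1 with hq
    -- The scale is small enough for the value of `f` to be at least `s / 2`, which exceeds `s` when
    -- `s < 0`.
    have h1 := hone (-s / (2 * (1 + |q|))) (by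
      have := abs_nonneg q
      apply div_pos <;> linarith)
    rw [map_smul, smul_eq_mul, ← hq] at h1
    have h2 := abs_nonneg q
    have h3 := neg_abs_le q
    have h4 : -s / (2 * (1 + |q|)) * q = -s * q / (2 * (1 + |q|)) := by ring
    rw [h4, div_lt_iff₀ (by linarith)] at h1
    nlinarith
  have hypos : ∀ e, 0 ≤ (2 * O e - 1) * (-y) e := by
    classical
    intro e
    by_contra h
    push Not at h
    simp only [Pi.neg_apply] at h
    have h5 : 0 < (2 * O e - 1) * y e := by linarith
    set q := f fun e => 2 * O e - 1 with hq
    -- Moving far along the coordinate `e` inside the orthant raises `f` to `q + |s - q| + 1 > s`.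
    have h1 := hf1 ((fun e => 2 * O e - 1) + Pi.single e
      ((|s - q| + 1) / ((2 * O e - 1) * y e) * (2 * O e - 1))) (by
      intro e'
      rw [Pi.add_apply, mul_add, hsq]
      by_cases he : e' = e
      · subst he
        rw [Pi.single_eq_same, mul_left_comm, hsq, mul_one]
        have : 0 ≤ (|s - q| + 1) / ((2 * O e' - 1) * y e') := by positivity
        linarith
      · simp [he])
    rw [map_add, ← hq, hfy (Pi.single _ _), single_dotProduct, mul_assoc, div_mul_cancel₀ _ h5.ne']
      at h1
    have := le_abs_self (s - q)
    linarith
  have hy0 : -y ≠ 0 := by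
    intro h
    rw [neg_eq_zero] at h
    have h1 := hone 1 one_pos
    have h2 := hf2 w' (by simp)
    rw [hfy, h, dotProduct_zero] at h1 h2
    linarith
  have := H.dot_pos_of_orientedBy hO hτ _ (-y) hyM hy0 hypos rfl
  rw [dotProduct_neg, ← hfy] at this
  have := hf2 w' (by simp)
  linarith

end SignedSpace
end OrientedMultigraph

namespace OrientedMultigraph

open scoped Matrix

variable {E : Type*} [Fintype E] {L M : Submodule ℝ (E → ℝ)} {X Y : Set (E → ℝ)}
  {σ τ : Finset (E → ℝ)} {w w' : E → ℝ}

/-- A point of the closed orthant of `O` can be moved a little along `z`, if `z` points into the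
orthant wherever the point is on the boundary. -/
theorem exists_step (O x z : E → ℝ) (hx : ∀ e, 0 ≤ (2 * O e - 1) * x e)
    (hz : ∀ e, x e = 0 → 0 ≤ (2 * O e - 1) * z e) (hO : O ∈ orientations E) :
    ∃ t : ℝ, 0 < t ∧ ∀ e, 0 ≤ (2 * O e - 1) * (x + t • z) e := by
  have h : ∀ e, ∃ t : ℝ, 0 < t ∧ ∀ s, 0 ≤ s → s ≤ t → 0 ≤ (2 * O e - 1) * (x e + s * z e) := by
    intro e
    have h1 := hx e
    by_cases h0 : x e = 0
    · refine ⟨1, one_pos, fun s hs _ => ?_⟩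
      have := mul_nonneg hs (hz e h0)
      rw [h0]; linarith
    · have h2 : 0 < (2 * O e - 1) * x e := by
        refine lt_of_le_of_ne h1 (Ne.symm (mul_ne_zero ?_ h0))
        rcases two_mul_sub_one hO e with h | h <;> rw [h] <;> norm_num
      refine ⟨(2 * O e - 1) * x e / (1 + |(2 * O e - 1) * z e|), by positivity,
        fun s hs hst => ?_⟩
      rw [le_div_iff₀ (by positivity)] at hst
      have h3 := neg_abs_le ((2 * O e - 1) * z e)
      have h4 := mul_le_mul_of_nonneg_left h3 hs
      linarith
  choose t ht hts using h
  by_cases hE : Nonempty E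
  · obtain ⟨e₀, -, he₀⟩ := Finset.exists_min_image Finset.univ t Finset.univ_nonempty
    exact ⟨t e₀, ht e₀, fun e => by
      simpa using hts e (t e₀) (ht e₀).le (he₀ e (Finset.mem_univ e))⟩
  · rw [not_nonempty_iff] at hE
    exact ⟨1, one_pos, fun e => hE.elim e⟩

/-- An orientation that is compatible on both sides belongs to a basis. -/
theorem SignedDuality.exists_certificate_of_orientedBy (H : SignedDuality L M X Y σ τ w w')
    {O : E → ℝ} (hO : O ∈ orientations E) (hσ : OrientedBy X σ O) (hτ : OrientedBy Y τ O) :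
    ∃ T u v, IsBasis L M T ∧ IsCertificate L M w w' O T u v := by
  obtain ⟨b, hbL, hb⟩ := H.right.exists_mem_orthant hO hτ
  obtain ⟨a, haM, ha⟩ := H.left.exists_mem_orthant hO hσ
  have hsq : ∀ e, (2 * O e - 1) * (2 * O e - 1) = 1 := by
    intro e
    rcases two_mul_sub_one hO e with h | h <;> rw [h] <;> norm_num
  -- The feasible set of a linear program, truncated at the value of `b`. As `a` lies in the open
  -- orthant, bounding `a ⬝ᵥ x` makes it compact; the support of a minimiser will be the basis.
  let P : Set (E → ℝ) := {x | (x - w' ∈ L ∧ ∀ e, 0 ≤ (2 * O e - 1) * x e) ∧ a ⬝ᵥ x ≤ a ⬝ᵥ b}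
  have hterm : ∀ x : E → ℝ, ∀ e, a e * x e = ((2 * O e - 1) * a e) * ((2 * O e - 1) * x e) := by
    intro x e
    have : ((2 * O e - 1) * a e) * ((2 * O e - 1) * x e) =
      ((2 * O e - 1) * (2 * O e - 1)) * (a e * x e) := by ring
    rw [this, hsq, one_mul]
  have hcont : Continuous fun x : E → ℝ => a ⬝ᵥ x := by
    unfold dotProduct; fun_prop
  have hPclosed : IsClosed P := by
    refine IsClosed.inter (IsClosed.inter ?_ ?_) ?_
    · exact (Submodule.closed_of_finiteDimensional L).preimage (continuous_id.sub continuous_const)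
    · have : IsClosed {x : E → ℝ | ∀ e, 0 ≤ (2 * O e - 1) * x e} := by
        simp only [Set.ofPred_forall]
        exact isClosed_iInter fun e => isClosed_le continuous_const (by fun_prop)
      exact this
    · exact isClosed_le hcont continuous_const
  have hPcompact : IsCompact P := by
    refine (isCompact_univ_pi fun e => isCompact_Icc (a := -((a ⬝ᵥ b) / ((2 * O e - 1) * a e)))
      (b := (a ⬝ᵥ b) / ((2 * O e - 1) * a e))).of_isClosed_subset hPclosed ?_
    rintro x ⟨⟨-, hx⟩, hxb⟩ e -
    rw [Set.mem_Icc, ← abs_le, le_div_iff₀ (ha e)]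
    have h1 : |x e| = (2 * O e - 1) * x e := by
      have := hx e
      rw [← abs_of_nonneg this, abs_mul]
      rcases two_mul_sub_one hO e with h | h <;> rw [h] <;> norm_num
    have h2 : a e * x e ≤ a ⬝ᵥ x := by
      refine Finset.single_le_sum (f := fun e => a e * x e) (fun e _ => ?_) (Finset.mem_univ e)
      simp only [hterm x]
      exact mul_nonneg (ha e).le (hx e)
    rw [hterm x] at h2
    rw [h1]
    linarith
  obtain ⟨x, ⟨⟨hxL, hx⟩, hxb⟩, hmin⟩ := hPcompact.exists_isMinOn
    ⟨b, ⟨hbL, fun e => (hb e).le⟩, le_rfl⟩ hcont.continuousOn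
  have hopt : ∀ z ∈ L, (∀ e, x e = 0 → 0 ≤ (2 * O e - 1) * z e) → 0 ≤ w ⬝ᵥ z := by
    intro z hz hze
    by_contra hneg
    push Not at hneg
    obtain ⟨t, ht, hxt⟩ := exists_step O x z hx hze hO
    have h1 : a ⬝ᵥ (x + t • z) = a ⬝ᵥ x + t * (w ⬝ᵥ z) := by
      rw [dotProduct_add, dotProduct_smul, smul_eq_mul, H.left.dot_congr hz haM]
    have h2 : t * (w ⬝ᵥ z) < 0 := mul_neg_of_pos_of_neg ht hneg
    have h3 : x + t • z ∈ P := by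
      refine ⟨⟨?_, hxt⟩, by linarith⟩
      rw [add_sub_right_comm]
      exact L.add_mem hxL (L.smul_mem _ hz)
    have h4 : a ⬝ᵥ x ≤ a ⬝ᵥ (x + t • z) := hmin h3
    linarith
  -- Nondegeneracy: a vector `c ∈ X` supported in the support of `x` would have both `c` and `-c` as
  -- feasible directions, forcing `w ⬝ᵥ c = 0`. A vector `d ∈ Y` vanishing on that support would
  -- have `w' ⬝ᵥ d = x ⬝ᵥ d = 0`.
  have hT : IsBasis L M (Function.support x) := by
    refine ⟨fun z hz hz0 => ?_, fun y hy hy0 => ?_⟩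
    · by_contra hne
      obtain ⟨c, hc, hcz⟩ := H.left.conformal z hz hne
      have hc0 : ∀ e, x e = 0 → c e = 0 := by
        intro e he
        by_contra h
        have := hcz e h
        simp [hz0 e (by simpa using he)] at this
      have h1 := hopt c (H.left.mem c hc) fun e he => by simp [hc0 e he]
      have h2 := hopt (-c) (L.neg_mem (H.left.mem c hc)) fun e he => by simp [hc0 e he]
      rw [dotProduct_neg] at h2
      exact H.left.dot_ne_zero hc (by linarith)
    · by_contra hne
      obtain ⟨d, hd, hdy⟩ := H.right.conformal y hy hne
      apply H.right.dot_ne_zero hd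
      rw [← H.right.dot_congr (H.right.mem d hd) hxL, dotProduct]
      refine Finset.sum_eq_zero fun e _ => ?_
      by_cases he : x e = 0
      · simp [he]
      · have : d e = 0 := by
          by_contra h
          have := hdy e h
          simp [hy0 e (by simpa using he)] at this
        simp [this]
  obtain ⟨v, hv, hv0⟩ := H.left.exists_reduced hT
  refine ⟨Function.support x, x, v, hT, hxL, hv, fun e he => by simpa using he, hv0,
    fun e he => ?_, fun e he => ?_⟩
  · refine lt_of_le_of_ne (hx e) (Ne.symm (mul_ne_zero ?_ he))
    rcases two_mul_sub_one hO e with h | h <;> rw [h] <;> norm_num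
  · obtain ⟨c, hc, hs, hce⟩ := H.left.exists_fundamental H.right hT he
    have hcX := H.left.sig_mem c hc
    have h1 : v e * c e = w ⬝ᵥ c := by
      rw [← SignedSpace.dot_fundamental hv0 hs, H.left.dot_congr (H.left.mem c hcX) hv]
    have h2 := H.left.pos c hc
    have hzero : ∀ f, x f = 0 → f ≠ e → c f = 0 := by
      intro f hf hfe
      by_contra h
      rcases hs h with h3 | h3
      · exact hfe h3
      · exact h3 hf
    -- Otherwise `-c` would be a feasible direction that decreases the objective.
    have h3 : 0 < (2 * O e - 1) * c e := by
      by_contra h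
      push Not at h
      have := hopt (-c) (L.neg_mem (H.left.mem c hcX)) fun f hf => by
        by_cases hfe : f = e
        · subst hfe
          simp only [Pi.neg_apply]; linarith
        · simp [hzero f hf hfe]
      rw [dotProduct_neg] at this
      linarith
    rcases two_mul_sub_one hO e with h | h <;> rw [h] at h3 ⊢ <;> nlinarith

/-! ### Reversals -/

/-- `O` arises from the certified orientation `P` by reversing `K ∈ L` and `D ∈ M`, both conformal
to `P` and with disjoint supports. -/
structure IsVectorReversal (L M : Submodule ℝ (E → ℝ)) (w w' : E → ℝ) (O P : E → ℝ) (T : Set E)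
    (K D u v : E → ℝ) : Prop where
  basis : IsBasis L M T
  mem : P ∈ orientations E
  cert : IsCertificate L M w w' P T u v
  memK : K ∈ L
  memD : D ∈ M
  conformK : ∀ e, K e = 0 ∨ K e = 2 * P e - 1
  conformD : ∀ e, D e = 0 ∨ D e = 2 * P e - 1
  disj : ∀ e, K e = 0 ∨ D e = 0
  eq : O = P - K - D

/-- The set attached to a reversal. -/
def modifiedBasis (T : Set E) (K D : E → ℝ) : Set E :=
  (T ∪ Function.support K) \ Function.support D

omit [Fintype E] in
theorem mem_modifiedBasis {T : Set E} {K D : E → ℝ} {e : E} :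
    e ∈ modifiedBasis T K D ↔ (e ∈ T ∨ K e ≠ 0) ∧ D e = 0 := by
  simp [modifiedBasis]

namespace IsVectorReversal

variable {O O₁ O₂ P P₁ P₂ K K₁ K₂ D D₁ D₂ u u₁ u₂ v v₁ v₂ : E → ℝ} {T T₁ T₂ : Set E}

omit [Fintype E] in
theorem symm (h : IsVectorReversal L M w w' O P T K D u v) :
    IsVectorReversal M L w' w O P Tᶜ D K v u :=
  ⟨h.basis.symm, h.mem, h.cert.symm, h.memD, h.memK, h.conformD, h.conformK,
    fun e => (h.disj e).symm, by rw [h.eq]; abel⟩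

-- Duality complements the attached set, so agreement on symmetric differences is a self-dual
-- condition.
omit [Fintype E] in
theorem mem_modifiedBasis_compl (h : IsVectorReversal L M w w' O P T K D u v) (e : E) :
    e ∈ modifiedBasis Tᶜ D K ↔ ¬ e ∈ modifiedBasis T K D := by
  rw [mem_modifiedBasis, mem_modifiedBasis, Set.mem_compl_iff]
  have := h.disj e
  tauto

omit [Fintype E] in
theorem sign_of_K_ne (h : IsVectorReversal L M w w' O P T K D u v) {e : E} (he : K e ≠ 0) :
    D e = 0 ∧ 2 * O e - 1 = -K e := by
  have h1 := (h.disj e).resolve_left he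
  have h2 := (h.conformK e).resolve_left he
  refine ⟨h1, ?_⟩
  rw [h.eq]
  simp only [Pi.sub_apply, h1]
  linarith

omit [Fintype E] in
theorem sign_of_D_ne (h : IsVectorReversal L M w w' O P T K D u v) {e : E} (he : D e ≠ 0) :
    2 * O e - 1 = -D e := (h.symm.sign_of_K_ne he).2

omit [Fintype E] in
theorem eq_of_zero (h : IsVectorReversal L M w w' O P T K D u v) {e : E} (hK : K e = 0)
    (hD : D e = 0) : O e = P e := by
  rw [h.eq]; simp [hK, hD]

/-- An edge where `K₁` and `D₂` are both nonzero lies in the first attached set only, so the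
orientations agree there and `K₁ e = D₂ e`. The inner product `K₁ ⬝ᵥ D₂` is then a sum of squares,
and it vanishes. -/
theorem disjoint_of_agree (H : SignedDuality L M X Y σ τ w w')
    (h₁ : IsVectorReversal L M w w' O₁ P₁ T₁ K₁ D₁ u₁ v₁)
    (h₂ : IsVectorReversal L M w w' O₂ P₂ T₂ K₂ D₂ u₂ v₂)
    (hagree : ∀ e, (e ∈ modifiedBasis T₁ K₁ D₁ ↔ e ∈ modifiedBasis T₂ K₂ D₂) ∨ O₁ e = O₂ e)
    (e : E) : K₁ e = 0 ∨ D₂ e = 0 := by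
  have h0 := H.left.dot_eq_zero h₁.memK h₂.memD
  have hpos : ∀ e, 0 ≤ K₁ e * D₂ e := by
    intro e
    by_cases hK : K₁ e = 0
    · simp [hK]
    by_cases hD : D₂ e = 0
    · simp [hD]
    obtain ⟨h3, h4⟩ := h₁.sign_of_K_ne hK
    have h5 := h₂.sign_of_D_ne hD
    have h6 : O₁ e = O₂ e := by
      refine (hagree e).resolve_left fun h => ?_
      rw [mem_modifiedBasis, mem_modifiedBasis] at h
      tauto
    have : D₂ e = K₁ e := by rw [h6] at h4; linarith
    rw [this]
    exact mul_self_nonneg _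
  rw [dotProduct, Finset.sum_eq_zero_iff_of_nonneg fun e _ => hpos e] at h0
  exact mul_eq_zero.1 (h0 e (Finset.mem_univ e))

/-- Off `T₂` the sign of `v₂` is that of `P₂`. If `K₂ e ≠ 0`, it is the extreme value in that
direction. If `K₂ e = 0 ≠ K₁ e`, the edge lies in the first attached set only, so agreement makes
`K₁` point against `P₂`. -/
theorem nonneg_of_agree (H : SignedDuality L M X Y σ τ w w')
    (h₁ : IsVectorReversal L M w w' O₁ P₁ T₁ K₁ D₁ u₁ v₁)
    (h₂ : IsVectorReversal L M w w' O₂ P₂ T₂ K₂ D₂ u₂ v₂)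
    (hagree : ∀ e, (e ∈ modifiedBasis T₁ K₁ D₁ ↔ e ∈ modifiedBasis T₂ K₂ D₂) ∨ O₁ e = O₂ e)
    (e : E) : 0 ≤ v₂ e * (K₂ - K₁) e := by
  rw [Pi.sub_apply]
  by_cases he : e ∈ T₂
  · simp [h₂.cert.v_zero e he]
  have hv := h₂.cert.v_sign e he
  by_cases hK₂ : K₂ e = 0
  · by_cases hK₁ : K₁ e = 0
    · simp [hK₁, hK₂]
    obtain ⟨h3, h4⟩ := h₁.sign_of_K_ne hK₁
    have hD := (h₁.disjoint_of_agree H h₂ hagree e).resolve_left hK₁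
    have h5 : O₁ e = O₂ e := by
      refine (hagree e).resolve_left fun h => ?_
      rw [mem_modifiedBasis, mem_modifiedBasis] at h
      tauto
    rw [← h₂.eq_of_zero hK₂ hD, ← h5, h4] at hv
    rw [hK₂]
    linarith
  · have h3 := (h₂.conformK e).resolve_left hK₂
    rw [h3]
    rcases two_mul_sub_one h₂.mem e with h | h <;> rw [h] at hv ⊢ <;>
      rcases h₁.conformK e with h4 | h4 <;> rw [h4] <;>
      rcases two_mul_sub_one h₁.mem e with h5 | h5 <;> (try rw [h5]) <;> linarith

/-- The numbers `v₂ ⬝ᵥ (K₂ - K₁)` and `v₁ ⬝ᵥ (K₁ - K₂)` are nonnegative, yet they are opposite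
values of `w`. Hence both vanish termwise, and `K₂ - K₁` is supported in the basis `T₂`. -/
theorem K_eq_of_agree (H : SignedDuality L M X Y σ τ w w')
    (h₁ : IsVectorReversal L M w w' O₁ P₁ T₁ K₁ D₁ u₁ v₁)
    (h₂ : IsVectorReversal L M w w' O₂ P₂ T₂ K₂ D₂ u₂ v₂)
    (hagree : ∀ e, (e ∈ modifiedBasis T₁ K₁ D₁ ↔ e ∈ modifiedBasis T₂ K₂ D₂) ∨ O₁ e = O₂ e) :
    K₁ = K₂ := by
  have hn₂ := h₁.nonneg_of_agree H h₂ hagree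
  have hn₁ := h₂.nonneg_of_agree H h₁ fun e => (hagree e).imp Iff.symm Eq.symm
  have hL : K₂ - K₁ ∈ L := L.sub_mem h₂.memK h₁.memK
  have hL' : K₁ - K₂ ∈ L := L.sub_mem h₁.memK h₂.memK
  have e2 : v₂ ⬝ᵥ (K₂ - K₁) = w ⬝ᵥ (K₂ - K₁) := H.left.dot_congr hL h₂.cert.v_mem
  have e1 : v₁ ⬝ᵥ (K₁ - K₂) = w ⬝ᵥ (K₁ - K₂) := H.left.dot_congr hL' h₁.cert.v_mem
  have p2 : 0 ≤ v₂ ⬝ᵥ (K₂ - K₁) := Finset.sum_nonneg fun e _ => hn₂ e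
  have p1 : 0 ≤ v₁ ⬝ᵥ (K₁ - K₂) := Finset.sum_nonneg fun e _ => hn₁ e
  have hz : v₂ ⬝ᵥ (K₂ - K₁) = 0 := by
    rw [e1, ← neg_sub, dotProduct_neg] at p1
    linarith
  rw [dotProduct, Finset.sum_eq_zero_iff_of_nonneg fun e _ => hn₂ e] at hz
  refine (sub_eq_zero.1 (h₂.basis.left _ hL fun e he => ?_)).symm
  have hv : v₂ e ≠ 0 := by
    intro h
    have := h₂.cert.v_sign e he
    simp [h] at this
  exact (mul_eq_zero.1 (hz e (Finset.mem_univ e))).resolve_left hv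

/-- Reversals of orientations that agree on the symmetric difference of the attached sets
coincide. -/
theorem eq_of_agree (H : SignedDuality L M X Y σ τ w w')
    (h₁ : IsVectorReversal L M w w' O₁ P₁ T₁ K₁ D₁ u₁ v₁)
    (h₂ : IsVectorReversal L M w w' O₂ P₂ T₂ K₂ D₂ u₂ v₂)
    (hagree : ∀ e, (e ∈ modifiedBasis T₁ K₁ D₁ ↔ e ∈ modifiedBasis T₂ K₂ D₂) ∨ O₁ e = O₂ e) :
    T₁ = T₂ ∧ K₁ = K₂ ∧ D₁ = D₂ ∧ O₁ = O₂ := by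
  have hK : K₁ = K₂ := h₁.K_eq_of_agree H h₂ hagree
  have hD : D₁ = D₂ := h₁.symm.K_eq_of_agree H.symm h₂.symm fun e => by
    rw [h₁.mem_modifiedBasis_compl, h₂.mem_modifiedBasis_compl]
    exact (hagree e).imp_left not_congr
  subst hK hD
  -- Where the common `K` or `D` is nonzero it determines both `P₁` and `P₂`; elsewhere the attached
  -- sets reduce to the bases and the orientations are unchanged.
  have hT : T₁ = T₂ := h₁.cert.basis_eq H h₁.mem h₂.cert fun e => by
    by_cases hK : K₁ e = 0
    · by_cases hD : D₁ e = 0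
      · rcases hagree e with h | h
        · left
          simpa [mem_modifiedBasis, hK, hD] using h
        · right
          rwa [h₁.eq_of_zero hK hD, h₂.eq_of_zero hK hD] at h
      · right
        linarith [(h₁.conformD e).resolve_left hD, (h₂.conformD e).resolve_left hD]
    · right
      linarith [(h₁.conformK e).resolve_left hK, (h₂.conformK e).resolve_left hK]
  subst hT
  refine ⟨rfl, rfl, rfl, ?_⟩
  rw [h₁.eq, h₂.eq, ← h₁.cert.eq_treeOrientation H h₁.basis h₁.mem,
    ← h₂.cert.eq_treeOrientation H h₂.basis h₂.mem]

end IsVectorReversal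

/-! ### Existence of reversals, and compatibility as `K = 0`. -/

omit [Fintype E] in
theorem finite_orientations [Finite E] : (orientations E).Finite := by
  have : orientations E = Set.univ.pi fun _ : E => ({0, 1} : Set ℝ) := by
    ext O; simp [orientations]
  rw [this]
  exact Set.Finite.pi fun _ => Set.toFinite _

/-- In every class modulo `L` there is a compatible orientation. -/
theorem SignedSpace.exists_orientedBy (H : SignedSpace L M X σ w) {O : E → ℝ}
    (hO : O ∈ orientations E) : ∃ O' ∈ orientations E, O' - O ∈ L ∧ OrientedBy X σ O' := by
  -- Take a maximiser of `w` in the class: reversing a wrongly directed vector would increase `w`.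
  obtain ⟨O', ⟨hO', hL⟩, hmax⟩ := Set.exists_max_image {O' | O' ∈ orientations E ∧ O' - O ∈ L}
    (fun x => w ⬝ᵥ x) (finite_orientations.subset fun _ h => h.1) ⟨O, hO, by simp⟩
  refine ⟨O', hO', hL, fun c hc hcO => ?_⟩
  by_contra hcσ
  have h1 := H.pos _ ((H.sig_or c hc).resolve_left hcσ)
  have h2 := hmax (O' - c) ⟨fun e => ?_, ?_⟩
  · rw [dotProduct_sub] at h2
    rw [dotProduct_neg] at h1
    linarith
  · rcases H.values c hc e with h | h | h
    · simpa [h] using hO' e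
    · simp [h, (hcO e).1 h]
    · simp [h, (hcO e).2 h]
  · rw [sub_right_comm]
    exact L.sub_mem hL (H.mem c hc)

/-- Every orientation is a reversal. -/
theorem SignedDuality.exists_isVectorReversal (H : SignedDuality L M X Y σ τ w w') {O : E → ℝ}
    (hO : O ∈ orientations E) : ∃ P T K D u v, IsVectorReversal L M w w' O P T K D u v := by
  obtain ⟨O₁, hO₁, hL, hσ⟩ := H.left.exists_orientedBy hO
  obtain ⟨O₂, hO₂, hM, hτ⟩ := H.right.exists_orientedBy hO₁
  have hconf : ∀ {A B : E → ℝ}, A ∈ orientations E → B ∈ orientations E → ∀ e, (A - B) e = 0 ∨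
      ((A - B) e = 2 * A e - 1 ∧ (A - B) e = - (2 * B e - 1)) := by
    intro A B hA hB e
    rcases hA e with h | h <;> rcases hB e with h' | h' <;> simp [h, h'] <;> norm_num
  -- An edge reversed twice has opposite entries in the two differences, so all products are
  -- nonpositive, and they sum to zero by orthogonality.
  have hdisj : ∀ e, (O₁ - O) e = 0 ∨ (O₂ - O₁) e = 0 := by
    have h0 := H.left.dot_eq_zero hL hM
    have hneg : ∀ e, (O₁ - O) e * (O₂ - O₁) e ≤ 0 := by
      intro e
      rcases hconf hO₁ hO e with h | h
      · simp [h]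
      rcases hconf hO₂ hO₁ e with h' | h'
      · simp [h']
      rw [h.1, h'.2]
      nlinarith [mul_self_nonneg (2 * O₁ e - 1)]
    rw [dotProduct, Finset.sum_eq_zero_iff_of_nonpos fun e _ => hneg e] at h0
    exact fun e => mul_eq_zero.1 (h0 e (Finset.mem_univ e))
  -- The second reversal preserves compatibility: a directed vector in `O₂` is orthogonal to `O₂ -
  -- O₁` with nonnegative terms, so it avoids the reversed edges and already lies in `O₁`.
  have hσ₂ : OrientedBy X σ O₂ := by
    intro c hc hcO
    have h0 := H.left.dot_eq_zero (H.left.mem c hc) hM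
    have hcs := hcO.nonneg (H.left.values c hc)
    have hpos : ∀ e, 0 ≤ c e * (O₂ - O₁) e := by
      intro e
      rcases hconf hO₂ hO₁ e with h' | h'
      · simp [h']
      rw [h'.1, mul_comm]
      exact hcs e
    rw [dotProduct, Finset.sum_eq_zero_iff_of_nonneg fun e _ => hpos e] at h0
    refine hσ c hc fun e => ?_
    by_cases h : c e = 0
    · simp [h]
    have h1 := (mul_eq_zero.1 (h0 e (Finset.mem_univ e))).resolve_left h
    rw [Pi.sub_apply, sub_eq_zero] at h1
    rw [← h1]
    exact hcO e
  obtain ⟨T, u, v, hT, hcert⟩ := H.exists_certificate_of_orientedBy hO₂ hσ₂ hτ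
  refine ⟨O₂, T, O₁ - O, O₂ - O₁, u, v, hT, hO₂, hcert, hL, hM, fun e => ?_, fun e => ?_, hdisj,
    by abel⟩
  · rcases hdisj e with h | h
    · exact Or.inl h
    · rw [Pi.sub_apply, sub_eq_zero] at h
      rw [h]
      exact (hconf hO₁ hO e).imp_right And.left
  · exact (hconf hO₂ hO₁ e).imp_right And.left

/-- Reversals that reverse nothing in `L` are exactly the compatible ones. -/
theorem IsVectorReversal.orientedBy_iff (H : SignedDuality L M X Y σ τ w w')
    {O P K D u v : E → ℝ} {T : Set E} (h : IsVectorReversal L M w w' O P T K D u v) :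
    OrientedBy X σ O ↔ K = 0 := by
  constructor
  · intro hO
    by_contra hK
    -- Such a `c` lies in `P` and `-c` lies in `O`; both would have to be chosen.
    obtain ⟨c, hc, hcK⟩ := H.left.conformal K h.memK hK
    have hval := H.left.values c hc
    have hcP : IsIn c P := by
      refine isIn_of_nonneg h.mem fun e => ?_
      by_cases he : c e = 0
      · simp [he]
      have h1 := hcK e he
      have h2 : K e ≠ 0 := fun h2 => by simp [h2] at h1
      rw [← (h.conformK e).resolve_left h2, mul_comm]
      exact h1.le
    have hcO : IsIn (-c) O := by
      intro e
      by_cases he : c e = 0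
      · simp [he]
      have h1 := hcK e he
      have h2 : K e ≠ 0 := fun h2 => by simp [h2] at h1
      have h3 := (h.sign_of_K_ne h2).2
      have h4 := (h.conformK e).resolve_left h2
      rcases two_mul_sub_one h.mem e with h5 | h5 <;> rw [h5] at h4 <;> rw [h4] at h1 h3 <;>
        constructor <;> intro h6 <;> simp only [Pi.neg_apply] at h6 <;> linarith
    exact H.left.neg_notMem (h.cert.orientedBy H h.basis c hc hcP)
      (hO (-c) (H.left.neg_mem c hc) hcO)
  · intro hK c hc hcO
    have h0 := H.left.dot_eq_zero (H.left.mem c hc) h.memD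
    have hcs := hcO.nonneg (H.left.values c hc)
    have hneg : ∀ e, c e * D e ≤ 0 := by
      intro e
      by_cases hD : D e = 0
      · simp [hD]
      have := h.sign_of_D_ne hD
      have h2 := hcs e
      rw [this] at h2
      linarith
    rw [dotProduct, Finset.sum_eq_zero_iff_of_nonpos fun e _ => hneg e] at h0
    refine h.cert.orientedBy H h.basis c hc fun e => ?_
    by_cases hce : c e = 0
    · simp [hce]
    have hD := (mul_eq_zero.1 (h0 e (Finset.mem_univ e))).resolve_left hce
    rw [← h.eq_of_zero (by simp [hK]) hD]
    exact hcO e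

end OrientedMultigraph

/-! ### Flows and cuts of a graph -/

namespace OrientedMultigraph

open scoped Matrix

/-- Inside the support of a vector of `L` there is a conformal vector of minimal support. -/
theorem exists_elementary {E : Type*} [Fintype E] (L : Submodule ℝ (E → ℝ)) {y : E → ℝ}
    (hy : y ∈ L) (hy0 : y ≠ 0) :
    ∃ z ∈ L, z ≠ 0 ∧ (∀ e, z e ≠ 0 → 0 < z e * y e) ∧
      ∀ u ∈ L, u ≠ 0 → Function.support u ⊆ Function.support z →
        Function.support z ⊆ Function.support u := by
  classical
  obtain ⟨z, ⟨hz, hz0, hzy⟩, hmin⟩ := WellFounded.has_min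
    (measure fun z : E → ℝ => (Function.support z).ncard).wf
    {z | z ∈ L ∧ z ≠ 0 ∧ ∀ e, z e ≠ 0 → 0 < z e * y e}
    ⟨y, hy, hy0, fun e he => mul_self_pos.2 he⟩
  refine ⟨z, hz, hz0, hzy, fun u hu hu0 hs => ?_⟩
  by_contra hns
  obtain ⟨e₁, he₁, hu₁⟩ := Set.not_subset.1 hns
  rw [Function.notMem_support] at hu₁
  obtain ⟨u, hu, hs, hu₁, e₂, he₂⟩ : ∃ u ∈ L, Function.support u ⊆ Function.support z ∧
      u e₁ = 0 ∧ ∃ e, 0 < u e * z e := by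
    obtain ⟨e, he⟩ := Function.ne_iff.1 hu0
    rcases lt_or_gt_of_ne (mul_ne_zero he (hs he)) with h | h
    · exact ⟨-u, L.neg_mem hu, by simpa using hs, by simp [hu₁], e, by
        rw [Pi.neg_apply]; linarith⟩
    · exact ⟨u, hu, hs, hu₁, e, h⟩
  obtain ⟨e₀, he₀, hle⟩ := Finset.exists_min_image (Finset.univ.filter fun e => 0 < u e * z e)
    (fun e => z e / u e) ⟨e₂, by simpa using he₂⟩
  simp only [Finset.mem_filter, Finset.mem_univ, true_and] at he₀ hle
  -- With this step `z - t • u` keeps the signs of `z` and loses `e₀`. It is nonzero since `u`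
  -- vanishes at `e₁`.
  set t := z e₀ / u e₀ with ht
  have hdiv : ∀ e, 0 < u e * z e → 0 < z e / u e := by
    intro e he
    rcases mul_pos_iff.1 he with h | h
    · exact div_pos h.2 h.1
    · exact div_pos_of_neg_of_neg h.2 h.1
  have htpos : 0 < t := hdiv e₀ he₀
  have hu₀ : u e₀ ≠ 0 := fun h => by simp [h] at he₀
  have hz' : ∀ e, (z - t • u) e = z e - t * u e := fun e => by simp
  have hnn : ∀ e, 0 ≤ (z - t • u) e * z e := by
    intro e
    rw [hz']
    by_cases h : 0 < u e * z e
    · have h1 := hle e h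
      have h2 : u e ≠ 0 := fun h' => by simp [h'] at h
      have h3 : t * (u e * z e) ≤ z e / u e * (u e * z e) := mul_le_mul_of_nonneg_right h1 h.le
      have h4 : z e / u e * (u e * z e) = z e * z e := by field_simp
      linarith
    · have h1 := mul_nonneg htpos.le (neg_nonneg.2 (not_lt.1 h))
      have h2 := mul_self_nonneg (z e)
      linarith
  have hsub : ∀ e, (z - t • u) e ≠ 0 → z e ≠ 0 := by
    intro e he h
    apply he
    have : u e = 0 := by
      by_contra h'
      exact hs h' h
    simp [h, this]
  refine hmin (z - t • u) ⟨L.sub_mem hz (L.smul_mem _ hu), ?_, fun e he => ?_⟩ ?_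
  · intro h
    have := congrFun h e₁
    rw [hz', hu₁, mul_zero, sub_zero] at this
    exact he₁ this
  · have h1 := hsub e he
    have h2 : 0 < (z - t • u) e * z e := lt_of_le_of_ne (hnn e) (mul_ne_zero he h1).symm
    have h3 := mul_pos h2 (hzy e h1)
    have h4 : (z - t • u) e * z e * (z e * y e) = (z e * z e) * ((z - t • u) e * y e) := by ring
    rw [h4] at h3
    exact (pos_iff_pos_of_mul_pos h3).1 (mul_self_pos.2 h1)
  · refine Set.ncard_lt_ncard ⟨hsub, fun h => ?_⟩ (Set.toFinite _)
    have h1 : z e₀ ≠ 0 := fun h' => by simp [h'] at he₀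
    apply h h1
    rw [hz', ht, div_mul_cancel₀ _ hu₀, sub_self]

/-! ### Cuts as differences of potentials. -/

variable {V E : Type*} (G : OrientedMultigraph V E)

/-- The difference of a potential along the edges. -/
def diff : (V → ℝ) →ₗ[ℝ] (E → ℝ) where
  toFun p e := p (G.tail e) - p (G.head e)
  map_add' p q := by ext e; simp only [Pi.add_apply]; ring
  map_smul' k p := by ext e; simp only [Pi.smul_apply, smul_eq_mul, RingHom.id_apply]; ring

theorem diff_apply (p : V → ℝ) (e : E) : G.diff p e = p (G.tail e) - p (G.head e) := rfl

/-- The space spanned by the cuts. -/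
def cutSpace : Submodule ℝ (E → ℝ) := LinearMap.range G.diff

theorem diff_mem (p : V → ℝ) : G.diff p ∈ G.cutSpace := LinearMap.mem_range_self _ p

open Classical in
theorem cutVector_eq_diff (W : Set V) :
    G.cutVector W = G.diff fun v => if v ∈ W then 1 else 0 := by
  ext e
  rw [diff_apply, cutVector]
  by_cases h1 : G.tail e ∈ W <;> by_cases h2 : G.head e ∈ W <;> simp [h1, h2]

theorem cutVector_mem (W : Set V) : G.cutVector W ∈ G.cutSpace := by
  rw [cutVector_eq_diff]; exact G.diff_mem _

theorem support_cutVector (W : Set V) : Function.support (G.cutVector W) = G.cut W := by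
  ext e
  simp only [Function.mem_support, cutVector, cut, Set.mem_ofPred_eq]
  by_cases h1 : G.tail e ∈ W <;> by_cases h2 : G.head e ∈ W <;> simp [h1, h2]

theorem cutVector_values (W : Set V) (e : E) :
    G.cutVector W e = 0 ∨ G.cutVector W e = 1 ∨ G.cutVector W e = -1 := by
  unfold cutVector
  split_ifs <;> simp

theorem cutVector_compl (W : Set V) : G.cutVector Wᶜ = -G.cutVector W := by
  ext e
  rw [Pi.neg_apply, cutVector, cutVector]
  by_cases h1 : G.tail e ∈ W <;> by_cases h2 : G.head e ∈ W <;> simp [h1, h2]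

theorem cut_compl (W : Set V) : G.cut Wᶜ = G.cut W := by
  rw [← support_cutVector, cutVector_compl, Function.support_neg, support_cutVector]

variable {G}

theorem IsDirectedCocycle.mem {d : E → ℝ} (h : G.IsDirectedCocycle d) : d ∈ G.cutSpace := by
  obtain ⟨W, -, rfl⟩ := h
  exact G.cutVector_mem W

theorem IsDirectedCocycle.isCocycle {d : E → ℝ} (h : G.IsDirectedCocycle d) :
    G.IsCocycle (Function.support d) := by
  obtain ⟨W, h, rfl⟩ := h
  rwa [support_cutVector]

theorem IsDirectedCocycle.ne_zero {d : E → ℝ} (h : G.IsDirectedCocycle d) : d ≠ 0 := by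
  rintro rfl
  simpa using h.isCocycle.prop.1

theorem IsDirectedCocycle.values {d : E → ℝ} (h : G.IsDirectedCocycle d) (e : E) :
    d e = 0 ∨ d e = 1 ∨ d e = -1 := by
  obtain ⟨W, -, rfl⟩ := h
  exact G.cutVector_values W e

theorem IsDirectedCocycle.neg {d : E → ℝ} (h : G.IsDirectedCocycle d) :
    G.IsDirectedCocycle (-d) := by
  obtain ⟨W, h, rfl⟩ := h
  exact ⟨Wᶜ, by rwa [cut_compl], (G.cutVector_compl W).symm⟩

variable [Fintype E]

/-- Take a conformal cut-space vector of minimal support, with potential `p`. A superlevel set of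
`p` separating the ends of some edge gives a conformal cut, and minimality of the support makes it a
cocycle. -/
theorem exists_conformal_cocycle {y : E → ℝ} (hy : y ∈ G.cutSpace) (hy0 : y ≠ 0) :
    ∃ d, G.IsDirectedCocycle d ∧ ∀ e, d e ≠ 0 → 0 < d e * y e := by
  obtain ⟨z, hz, hz0, hzy, hmin⟩ := exists_elementary G.cutSpace hy hy0
  obtain ⟨p, rfl⟩ := hz
  obtain ⟨f, hf⟩ := Function.ne_iff.1 hz0
  rw [diff_apply, Pi.zero_apply, sub_ne_zero] at hf
  set W : Set V := {v | max (p (G.tail f)) (p (G.head f)) ≤ p v} with hW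
  have hconf : ∀ e, G.cutVector W e ≠ 0 → 0 < G.cutVector W e * G.diff p e := by
    intro e he
    rw [diff_apply]
    unfold cutVector at he ⊢
    simp only [hW, Set.mem_ofPred_eq, not_le] at he ⊢
    split_ifs with h1 h2
    · linarith [h1.1, h1.2]
    · linarith [h2.1, h2.2]
    · rw [if_neg h1, if_neg h2] at he
      exact absurd rfl he
  have hfW : f ∈ G.cut W := by
    simp only [cut, hW, Set.mem_ofPred_eq, max_le_iff, le_refl]
    rcases lt_or_gt_of_ne hf with h | h
    · right; simp [h, h.le]
    · left; simp [h, h.le]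
  have hne : G.cutVector W ≠ 0 := by
    intro h
    rw [← support_cutVector, h] at hfW
    simp at hfW
  have hsub : Function.support (G.cutVector W) ⊆ Function.support (G.diff p) := by
    intro e he h
    have := hconf e he
    simp [h] at this
  refine ⟨G.cutVector W, ⟨W, ⟨⟨⟨f, hfW⟩, W, rfl⟩, ?_⟩, rfl⟩, fun e he => ?_⟩
  · rintro D ⟨⟨e, he⟩, W', rfl⟩ hD
    rw [← support_cutVector] at he
    rw [← support_cutVector, ← support_cutVector] at hD ⊢
    have h1 : G.cutVector W' ≠ 0 := fun h => by simp [h] at he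
    exact hsub.trans (hmin _ (G.cutVector_mem W') h1 (hD.trans hsub))
  · have h1 := hconf e he
    have h2 : G.diff p e ≠ 0 := hsub he
    have h3 := mul_pos h1 (hzy e h2)
    have h4 : G.cutVector W e * G.diff p e * (G.diff p e * y e) =
      (G.diff p e * G.diff p e) * (G.cutVector W e * y e) := by ring
    rw [h4] at h3
    exact (pos_iff_pos_of_mul_pos h3).1 (mul_self_pos.2 h2)

/-- Otherwise a cocycle conformal to `d - d'` lies inside the support of `d` but misses an edge
where `d = d'`, contradicting minimality. -/
theorem IsDirectedCocycle.eq_or_eq_neg {d d' : E → ℝ} (h : G.IsDirectedCocycle d)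
    (h' : G.IsDirectedCocycle d') (hs : Function.support d = Function.support d') :
    d = d' ∨ d = -d' := by
  by_contra hno
  push Not at hno
  obtain ⟨d'', hd, hconf⟩ := exists_conformal_cocycle (G.cutSpace.sub_mem h.mem h'.mem)
    (sub_ne_zero.2 hno.1)
  obtain ⟨e, he⟩ := Function.ne_iff.1 hno.2
  have h0 : d e = 0 ↔ d' e = 0 := by
    have := congrArg (e ∈ ·) hs
    simp only [Function.mem_support, ne_eq, eq_iff_iff] at this
    tauto
  have hde : d e = d' e ∧ d e ≠ 0 := by
    rw [Pi.neg_apply] at he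
    rcases h.values e with h1 | h1 | h1 <;> rcases h'.values e with h2 | h2 | h2 <;>
      simp [h1, h2] at h0 he ⊢
  have hsub : Function.support d'' ⊆ Function.support d := by
    intro f hf
    have := hconf f hf
    by_contra hf'
    rw [Function.notMem_support] at hf'
    have h2 : d' f = 0 := by
      by_contra h2
      have : f ∈ Function.support d' := h2
      rw [← hs] at this
      exact this hf'
    simp [hf', h2] at this
  have := h.isCocycle.le_of_le hd.isCocycle.prop hsub hde.2
  have := hconf e this
  simp [hde.1] at this

/-! ### Flows -/

variable (G) in
/-- The space of flows. -/
def flowSpace : Submodule ℝ (E → ℝ) where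
  carrier := {z | ∀ p, z ⬝ᵥ G.diff p = 0}
  add_mem' := fun {a b} ha hb p => by rw [add_dotProduct, ha p, hb p, add_zero]
  zero_mem' := fun p => zero_dotProduct _
  smul_mem' := fun k a ha p => by rw [smul_dotProduct, ha p, smul_zero]

theorem mem_flowSpace_iff (z : E → ℝ) : z ∈ G.flowSpace ↔ ∀ y ∈ G.cutSpace, z ⬝ᵥ y = 0 := by
  constructor
  · rintro h _ ⟨p, rfl⟩
    exact h p
  · exact fun h p => h _ (G.diff_mem p)

theorem mem_cutSpace_iff (y : E → ℝ) : y ∈ G.cutSpace ↔ ∀ z ∈ G.flowSpace, y ⬝ᵥ z = 0 := by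
  constructor
  · intro hy z hz
    rw [dotProduct_comm]
    exact (mem_flowSpace_iff z).1 hz y hy
  · intro h
    by_contra hy
    obtain ⟨f, hf, hf'⟩ := Submodule.exists_le_ker_of_notMem hy
    obtain ⟨z, hz⟩ := exists_dotProduct_eq f
    apply hf
    rw [hz]
    refine h z fun p => ?_
    rw [dotProduct_comm, ← hz]
    exact hf' (G.diff_mem p)

/-- The vector `u` is kept separate from `c` so that a second cycle on the same edges can be tested
too. -/
theorem dot_diff_of_walk {n : ℕ} {v : Fin (n + 1) → V} {a : Fin (n + 1) → E} {c u : E → ℝ}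
    (ha : Function.Injective a)
    (hc : ∀ i, (c (a i) = 1 ∧ G.tail (a i) = v i ∧ G.head (a i) = v (i + 1)) ∨
      (c (a i) = -1 ∧ G.head (a i) = v i ∧ G.tail (a i) = v (i + 1)))
    (hu : ∀ e, e ∉ Set.range a → u e = 0) (p : V → ℝ) :
    u ⬝ᵥ G.diff p = ∑ i, u (a i) * c (a i) * (p (v i) - p (v (i + 1))) := by
  symm
  refine Fintype.sum_of_injective a ha _ _ (fun e he => by simp [hu e he]) fun i => ?_
  rw [diff_apply]
  rcases hc i with ⟨h1, h2, h3⟩ | ⟨h1, h2, h3⟩ <;> rw [h1, h2, h3] <;> ring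

omit [Fintype E] in
theorem IsDirectedCycle.values {c : E → ℝ} (h : G.IsDirectedCycle c) (e : E) :
    c e = 0 ∨ c e = 1 ∨ c e = -1 := by
  obtain ⟨n, v, a, -, -, hc, h0⟩ := h
  by_cases he : e ∈ Set.range a
  · obtain ⟨i, rfl⟩ := he
    rcases hc i with h | h
    · exact Or.inr (Or.inl h.1)
    · exact Or.inr (Or.inr h.1)
  · exact Or.inl (h0 e he)

omit [Fintype E] in
theorem IsDirectedCycle.ne_zero {c : E → ℝ} (h : G.IsDirectedCycle c) : c ≠ 0 := by
  obtain ⟨n, v, a, -, -, hc, -⟩ := h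
  rintro rfl
  simpa using hc 0

omit [Fintype E] in
theorem IsDirectedCycle.neg {c : E → ℝ} (h : G.IsDirectedCycle c) : G.IsDirectedCycle (-c) := by
  obtain ⟨n, v, a, hv, ha, hc, h0⟩ := h
  -- Backwards, the step from `v (-i)` to `v (-i - 1)` uses the edge `a (-i - 1)`, hence the shift.
  refine ⟨n, fun i => v (-i), fun i => a (-i - 1), fun i j h => neg_injective (hv h),
    fun i j h => neg_injective (sub_left_injective (ha h)), fun i => ?_, fun e he => ?_⟩
  · have h1 := hc (-i - 1)
    rw [sub_add_cancel] at h1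
    have h2 : -(i + 1) = -i - 1 := by abel
    simp only [Pi.neg_apply, h2]
    rcases h1 with h | h
    · exact Or.inr ⟨by rw [h.1], h.2.2, h.2.1⟩
    · exact Or.inl ⟨by rw [h.1, neg_neg], h.2.2, h.2.1⟩
  · rw [Pi.neg_apply, h0 e, neg_zero]
    rintro ⟨i, rfl⟩
    exact he ⟨-(i + 1), by simp⟩

theorem IsDirectedCycle.mem {c : E → ℝ} (h : G.IsDirectedCycle c) : c ∈ G.flowSpace := by
  obtain ⟨n, v, a, hv, ha, hc, h0⟩ := h
  intro p
  rw [dot_diff_of_walk ha hc h0]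
  have h1 : ∀ i, c (a i) * c (a i) = 1 := by
    intro i
    rcases hc i with h | h <;> rw [h.1] <;> norm_num
  simp only [h1, one_mul, Finset.sum_sub_distrib]
  rw [sub_eq_zero]
  exact (Equiv.sum_comp (Equiv.addRight (1 : Fin (n + 1))) fun i => p (v i)).symm

theorem IsDirectedCycle.eq_or_eq_neg {c c' : E → ℝ} (h : G.IsDirectedCycle c)
    (h' : G.IsDirectedCycle c') (hs : Function.support c' = Function.support c) :
    c' = c ∨ c' = -c := by
  classical
  have hval := h'.values
  have hmem := h'.mem
  obtain ⟨n, v, a, hv, ha, hc, h0⟩ := h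
  have hsupp : ∀ e, c e = 0 → c' e = 0 := by
    intro e he
    by_contra h1
    have : e ∈ Function.support c' := h1
    rw [hs] at this
    exact this he
  have h0' : ∀ e, e ∉ Set.range a → c' e = 0 := fun e he => hsupp e (h0 e he)
  have hstep : ∀ k, c' (a (k + 1)) * c (a (k + 1)) = c' (a k) * c (a k) := by
    intro k
    -- Conservation at the vertex `v (k + 1)` compares the two consecutive edges of the cycle there.
    have := hmem (Pi.single (v (k + 1)) 1)
    rw [dot_diff_of_walk ha hc h0'] at this
    simp only [Pi.single_apply, hv.eq_iff, add_left_inj, mul_sub, mul_ite, mul_one, mul_zero,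
      Finset.sum_sub_distrib, Finset.sum_ite_eq', Finset.mem_univ, if_true] at this
    linarith
  have hconst : ∀ k, c' (a k) * c (a k) = c' (a 0) * c (a 0) := by
    intro k
    induction k using Fin.induction with
    | zero => rfl
    | succ i ih => rw [← ih, ← Fin.coeSucc_eq_succ, hstep]
  have hsq : ∀ i, c (a i) * c (a i) = 1 := by
    intro i
    rcases hc i with h | h <;> rw [h.1] <;> norm_num
  have hall : ∀ e, c' e = c' (a 0) * c (a 0) * c e := by
    intro e
    by_cases he : e ∈ Set.range a
    · obtain ⟨i, rfl⟩ := he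
      rw [← hconst i, mul_assoc, hsq, mul_one]
    · rw [h0 e he, h0' e he, mul_zero]
  have hc'0 : c' (a 0) ≠ 0 := by
    have : a 0 ∈ Function.support c := by
      intro h
      have := hsq 0
      simp [h] at this
    rwa [← hs] at this
  have : c' (a 0) * c (a 0) = 1 ∨ c' (a 0) * c (a 0) = -1 := by
    rcases hval (a 0) with h | h | h
    · exact absurd h hc'0
    · rcases hc 0 with h1 | h1 <;> rw [h, h1.1] <;> norm_num
    · rcases hc 0 with h1 | h1 <;> rw [h, h1.1] <;> norm_num
  rcases this with h | h
  · left; ext e; rw [hall e, h, one_mul]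
  · right; ext e; rw [hall e, h, neg_one_mul, Pi.neg_apply]

/-- Direct each edge of the support along `z`. By conservation a vertex that is entered can be left
again; following one chosen exit per vertex becomes periodic, and a minimal period traces a simple
directed cycle. -/
theorem exists_conformal_cycle [Finite V] {z : E → ℝ} (hz : z ∈ G.flowSpace) (hz0 : z ≠ 0) :
    ∃ c, G.IsDirectedCycle c ∧ ∀ e, c e ≠ 0 → 0 < c e * z e := by
  classical
  let src : E → V := fun e => if 0 < z e then G.tail e else G.head e
  let dst : E → V := fun e => if 0 < z e then G.head e else G.tail e
  have hdot : ∀ p : V → ℝ, ∑ e, |z e| * (p (src e) - p (dst e)) = 0 := by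
    intro p
    rw [← hz p]
    refine Finset.sum_congr rfl fun e _ => ?_
    simp only [src, dst, diff_apply]
    split_ifs with h
    · rw [abs_of_pos h]
    · rw [abs_of_nonpos (not_lt.1 h)]; ring
  have hout : ∀ e, z e ≠ 0 → ∃ e', z e' ≠ 0 ∧ src e' = dst e := by
    intro e he
    by_contra hno
    push Not at hno
    have h1 := hdot (Pi.single (dst e) 1)
    have h2 : ∀ f, |z f| * ((Pi.single (dst e) 1 : V → ℝ) (src f) -
        (Pi.single (dst e) 1 : V → ℝ) (dst f)) ≤ 0 := by
      intro f
      by_cases hf : z f = 0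
      · simp [hf]
      · rw [Pi.single_eq_of_ne (hno f hf), zero_sub]
        have h3 : 0 ≤ (Pi.single (dst e) 1 : V → ℝ) (dst f) := by
          rw [Pi.single_apply]; split_ifs <;> norm_num
        nlinarith [abs_nonneg (z f)]
    rw [Finset.sum_eq_zero_iff_of_nonpos fun f _ => h2 f] at h1
    have h4 := h1 e (Finset.mem_univ e)
    rw [Pi.single_eq_of_ne (hno e he), Pi.single_eq_same] at h4
    simp [he] at h4
  let U := {v : V // ∃ e, z e ≠ 0 ∧ src e = v}
  choose ed hed0 hedsrc using fun v : U => v.2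
  let next : U → U := fun v => ⟨dst (ed v), hout _ (hed0 v)⟩
  obtain ⟨f, hf⟩ := Function.ne_iff.1 hz0
  have : Nonempty U := ⟨⟨src f, f, hf, rfl⟩⟩
  obtain ⟨x, hx⟩ : ∃ x, x ∈ Function.periodicPts next := by
    obtain ⟨m, n, hmn, h⟩ := Finite.exists_ne_map_eq_of_infinite
      fun k : ℕ => next^[k] (Classical.arbitrary U)
    wlog hlt : m < n generalizing m n
    · exact this n m hmn.symm h.symm (by omega)
    refine ⟨next^[m] (Classical.arbitrary U), Function.mk_mem_periodicPts (n := n - m)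
      (by omega) ?_⟩
    rw [Function.IsPeriodicPt, Function.IsFixedPt, ← Function.iterate_add_apply]
    rw [Nat.sub_add_cancel hlt.le]
    exact h.symm
  obtain ⟨n, hn⟩ : ∃ n, Function.minimalPeriod next x = n + 1 :=
    ⟨_, (Nat.succ_pred_eq_of_pos (Function.minimalPeriod_pos_of_mem_periodicPts hx)).symm⟩
  have hinj : Function.Injective fun i : Fin (n + 1) => next^[i] x := by
    intro i j hij
    exact Fin.ext (Function.iterate_injOn_Iio_minimalPeriod (f := next) (x := x)
      (by rw [hn]; exact i.2) (by rw [hn]; exact j.2) hij)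
  -- The wrap-around of `Fin (n + 1)` matches the minimal period `n + 1`.
  have hnext : ∀ i : Fin (n + 1), next^[(i + 1 : Fin (n + 1))] x = next (next^[i] x) := by
    intro i
    rw [← Function.iterate_succ_apply' next, ← Function.iterate_mod_minimalPeriod_eq, hn]
    rw [← Function.iterate_mod_minimalPeriod_eq (n := (i : ℕ).succ), hn]
    simp only [Fin.val_add, Fin.val_one', Nat.mod_mod, Nat.add_mod_mod, Nat.succ_eq_add_one]
  have hsrcinj : ∀ v v' : U, ed v = ed v' → v = v' := fun v v' h =>
    Subtype.ext (by rw [← hedsrc v, ← hedsrc v', h])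
  let v : Fin (n + 1) → V := fun i => (next^[i] x).1
  let a : Fin (n + 1) → E := fun i => ed (next^[i] x)
  refine ⟨fun e => if e ∈ Set.range a then (if 0 < z e then 1 else -1) else 0,
    ⟨n, v, a, fun i j h => hinj (Subtype.ext h), fun i j h => hinj (hsrcinj _ _ h),
      fun i => ?_, fun e he => if_neg he⟩, fun e he => ?_⟩
  · have h1 : src (a i) = v i := hedsrc _
    have h2 : dst (a i) = v (i + 1) := by
      simp only [v, hnext i]
      rfl
    simp only [src, dst] at h1 h2
    beta_reduce
    rw [if_pos (Set.mem_range_self i : a i ∈ Set.range a)]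
    split_ifs at h1 h2 ⊢ with h
    · exact Or.inl ⟨rfl, h1, h2⟩
    · exact Or.inr ⟨rfl, h1, h2⟩
  · simp only at he ⊢
    by_cases h : e ∈ Set.range a
    · rw [if_pos h]
      have hze : z e ≠ 0 := by
        obtain ⟨i, rfl⟩ := h
        exact hed0 _
      split_ifs with h1
      · linarith
      · have := lt_of_le_of_ne (not_lt.1 h1) hze
        linarith
    · simp [h] at he

/-! ### Signatures and spanning trees -/

/-- Acyclicity keeps `0` out of the convex hull of the finite set `σ`; strict separation yields `w`.
-/
theorem IsAcyclic.exists_pos {σ : Finset (E → ℝ)} (h : IsAcyclic σ) :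
    ∃ w : E → ℝ, ∀ c ∈ σ, 0 < w ⬝ᵥ c := by
  have h0 : (0 : E → ℝ) ∉ convexHull ℝ (σ : Set (E → ℝ)) := by
    rw [Finset.mem_convexHull']
    rintro ⟨a, ha, hsum, hz⟩
    have := h a ha hz
    rw [Finset.sum_eq_zero this] at hsum
    exact zero_ne_one hsum
  obtain ⟨f, s, t, hf, hst, ht⟩ := geometric_hahn_banach_compact_closed (convex_singleton (0 : E → ℝ))
    isCompact_singleton (convex_convexHull ℝ _)
    (σ.finite_toSet.isCompact_convexHull (𝕜 := ℝ)).isClosed (Set.disjoint_singleton_left.2 h0)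
  obtain ⟨w, hw⟩ := exists_dotProduct_eq f.toLinearMap
  refine ⟨w, fun c hc => ?_⟩
  have h1 := hf 0 rfl
  have h2 := ht c (subset_convexHull ℝ _ hc)
  rw [map_zero] at h1
  rw [dotProduct_comm, ← hw]
  exact (h1.trans hst).trans h2

theorem exists_signedDuality [Finite V] {σ τ : Finset (E → ℝ)} (hσ : G.IsCycleSignature σ)
    (hσa : IsAcyclic σ) (hτ : G.IsCocycleSignature τ) (hτa : IsAcyclic τ) :
    ∃ w w', SignedDuality G.flowSpace G.cutSpace {c | G.IsDirectedCycle c}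
      {d | G.IsDirectedCocycle d} σ τ w w' := by
  obtain ⟨w, hw⟩ := hσa.exists_pos
  obtain ⟨w', hw'⟩ := hτa.exists_pos
  refine ⟨w, w', ?_, ?_⟩
  · refine ⟨mem_flowSpace_iff, fun _ => IsDirectedCycle.mem, fun _ => IsDirectedCycle.ne_zero,
      fun _ => IsDirectedCycle.values, fun _ => exists_conformal_cycle, fun _ => IsDirectedCycle.neg,
      hσ.1, fun c hc => ?_, hw⟩
    obtain ⟨c', ⟨hc', hs⟩, -⟩ := hσ.2 _ ⟨c, hc, rfl⟩
    rcases IsDirectedCycle.eq_or_eq_neg hc (hσ.1 c' hc') hs with rfl | rfl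
    · exact Or.inl hc'
    · exact Or.inr hc'
  · refine ⟨mem_cutSpace_iff, fun _ => IsDirectedCocycle.mem, fun _ => IsDirectedCocycle.ne_zero,
      fun _ => IsDirectedCocycle.values, fun _ => exists_conformal_cocycle,
      fun _ => IsDirectedCocycle.neg, hτ.1, fun d hd => ?_, hw'⟩
    obtain ⟨d', ⟨hd', hs⟩, -⟩ := hτ.2 _ (IsDirectedCocycle.isCocycle hd)
    rcases (hτ.1 d' hd').eq_or_eq_neg hd hs with rfl | rfl
    · exact Or.inl hd'
    · exact Or.inr hd'

theorem isSpanningForest_iff [Finite V] {F : Set E} :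
    G.IsSpanningForest F ↔ ∀ z ∈ G.flowSpace, (∀ e, e ∉ F → z e = 0) → z = 0 := by
  constructor
  · intro h z hz hF
    by_contra hz0
    obtain ⟨c, hc, hcz⟩ := exists_conformal_cycle hz hz0
    refine h _ ⟨c, hc, rfl⟩ fun e he => ?_
    by_contra heF
    have := hcz e he
    simp [hF e heF] at this
  · rintro h C ⟨c, hc, rfl⟩ hF
    exact hc.ne_zero (h c hc.mem fun e he => by
      by_contra h0
      exact he (hF h0))

/-- If `T` connects all vertices, a potential constant along `T` is constant. Conversely, the cut
vector of the set reachable through `T` vanishes on `T`, hence everywhere, and connectedness of the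
graph finishes. -/
theorem isSpanningTree_iff [Finite V] (hG : G.IsConnected) {T : Set E} :
    G.IsSpanningTree T ↔ IsBasis G.flowSpace G.cutSpace T := by
  constructor
  · rintro ⟨hc, hF⟩
    refine ⟨isSpanningForest_iff.1 hF, ?_⟩
    rintro _ ⟨p, rfl⟩ h0
    have hp : ∀ u v, p u = p v := by
      intro u v
      induction hc u v with
      | refl => rfl
      | tail _ hbc ih =>
        obtain ⟨e, he, h⟩ := hbc
        have h1 := h0 e he
        rw [diff_apply, sub_eq_zero] at h1
        rcases h with ⟨rfl, rfl⟩ | ⟨rfl, rfl⟩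
        · exact ih.trans h1
        · exact ih.trans h1.symm
    ext e
    rw [diff_apply, hp (G.tail e) (G.head e), sub_self, Pi.zero_apply]
  · intro h
    refine ⟨fun u v => ?_, isSpanningForest_iff.2 h.left⟩
    set W : Set V := {v | Relation.ReflTransGen
      (fun a b => ∃ e ∈ T, (G.tail e = a ∧ G.head e = b) ∨ (G.tail e = b ∧ G.head e = a)) u v}
      with hW
    have h0 : ∀ e, e ∈ T → (G.tail e ∈ W ↔ G.head e ∈ W) := fun e he =>
      ⟨fun h1 => Relation.ReflTransGen.tail h1 ⟨e, he, Or.inl ⟨rfl, rfl⟩⟩,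
        fun h1 => Relation.ReflTransGen.tail h1 ⟨e, he, Or.inr ⟨rfl, rfl⟩⟩⟩
    have h1 := h.right _ (G.cutVector_mem W) fun e he => by
      have := h0 e he
      unfold cutVector
      by_cases h2 : G.head e ∈ W <;> simp [this, h2]
    have h2 : ∀ e, G.tail e ∈ W ↔ G.head e ∈ W := by
      intro e
      have h3 : e ∉ G.cut W := by
        rw [← support_cutVector, h1]; simp
      simp only [cut, Set.mem_ofPred_eq] at h3
      tauto
    change v ∈ W
    induction hG.2 u v with
    | refl => exact Relation.ReflTransGen.refl
    | tail _ hbc ih =>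
      obtain ⟨e, -, ⟨rfl, rfl⟩ | ⟨rfl, rfl⟩⟩ := hbc
      · exact (h2 e).1 ih
      · exact (h2 e).2 ih

end OrientedMultigraph

/-! ### The map from orientations to spanning subgraphs -/

namespace OrientedMultigraph

open scoped Matrix

theorem sum_apply_of_disjoint {E : Type*} {𝒞 : Finset (E → ℝ)}
    (h : (𝒞 : Set (E → ℝ)).PairwiseDisjoint Function.support) {c : E → ℝ} (hc : c ∈ 𝒞) {e : E}
    (he : c e ≠ 0) : (∑ c ∈ 𝒞, c) e = c e := by
  rw [Finset.sum_apply]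
  refine Finset.sum_eq_single_of_mem c hc fun c' hc' hne => ?_
  by_contra h0
  exact Set.disjoint_left.1 (h hc' hc hne) h0 he

theorem exists_of_sum_apply_ne_zero {E : Type*} {𝒞 : Finset (E → ℝ)} {e : E}
    (he : (∑ c ∈ 𝒞, c) e ≠ 0) : ∃ c ∈ 𝒞, c e ≠ 0 := by
  rw [Finset.sum_apply] at he
  exact Finset.exists_ne_zero_of_sum_ne_zero he

theorem support_sum_of_disjoint {E : Type*} {𝒞 : Finset (E → ℝ)}
    (h : (𝒞 : Set (E → ℝ)).PairwiseDisjoint Function.support) :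
    Function.support (∑ c ∈ 𝒞, c) = ⋃ c ∈ 𝒞, Function.support c := by
  ext e
  simp only [Set.mem_iUnion, Function.mem_support, exists_prop]
  constructor
  · exact exists_of_sum_apply_ne_zero
  · rintro ⟨c, hc, he⟩
    rwa [sum_apply_of_disjoint h hc he]

theorem sum_conform {E : Type*} {𝒞 : Finset (E → ℝ)} {P : E → ℝ}
    (h : (𝒞 : Set (E → ℝ)).PairwiseDisjoint Function.support)
    (hv : ∀ c ∈ 𝒞, ∀ e, c e = 0 ∨ c e = 1 ∨ c e = -1) (hP : ∀ c ∈ 𝒞, IsIn c P) (e : E) :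
    (∑ c ∈ 𝒞, c) e = 0 ∨ (∑ c ∈ 𝒞, c) e = 2 * P e - 1 := by
  by_cases h0 : (∑ c ∈ 𝒞, c) e = 0
  · exact Or.inl h0
  obtain ⟨c, hc, he⟩ := exists_of_sum_apply_ne_zero h0
  rw [sum_apply_of_disjoint h hc he]
  rcases hv c hc e with h1 | h1 | h1
  · exact Or.inl h1
  · right; rw [h1, (hP c hc e).1 h1]; norm_num
  · right; rw [h1, (hP c hc e).2 h1]; norm_num

theorem isIn_of_conform {E : Type*} {c K P : E → ℝ} (hcK : ∀ e, c e ≠ 0 → c e = K e)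
    (hK : ∀ e, K e = 0 ∨ K e = 2 * P e - 1) : IsIn c P := by
  intro e
  by_cases h : c e = 0
  · simp [h]
  have h1 := hcK e h
  have h2 := (hK e).resolve_left (h1 ▸ h)
  constructor <;> intro h3 <;> linarith

variable {V E : Type*} {G : OrientedMultigraph V E} [Finite V] [Fintype E]
  {σ τ : Finset (E → ℝ)} {w w' : E → ℝ}

/-- Disjoint supports prevent cancellation, so the sums of the two families retain the signs and the
union of supports. -/
theorem IsReversal.isVectorReversal (hG : G.IsConnected)
    (H : SignedDuality G.flowSpace G.cutSpace {c | G.IsDirectedCycle c}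
      {d | G.IsDirectedCocycle d} σ τ w w')
    {O P : E → ℝ} {T : Set E} {𝒞 𝒟 : Finset (E → ℝ)} (h : G.IsReversal σ τ O P T 𝒞 𝒟) :
    (∃ u v, IsVectorReversal G.flowSpace G.cutSpace w w' O P T (∑ c ∈ 𝒞, c) (∑ d ∈ 𝒟, d) u v) ∧
      modifiedTree T 𝒞 𝒟 = modifiedBasis T (∑ c ∈ 𝒞, c) (∑ d ∈ 𝒟, d) := by
  have hT := (isSpanningTree_iff hG).1 h.tree
  obtain ⟨u, v, huv⟩ := H.exists_certificate hT
  rw [h.tree_eq] at huv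
  refine ⟨⟨u, v, hT, h.compatible.1, huv, Submodule.sum_mem _ fun c hc => (h.cycles c hc).1.mem,
    Submodule.sum_mem _ fun d hd => (h.cocycles d hd).1.mem,
    sum_conform h.disjoint_cycles (fun c hc => (h.cycles c hc).1.values)
      fun c hc => (h.cycles c hc).2,
    sum_conform h.disjoint_cocycles (fun d hd => (h.cocycles d hd).1.values)
      fun d hd => (h.cocycles d hd).2, fun e => ?_, h.reversed⟩, ?_⟩
  · by_contra hno
    push Not at hno
    obtain ⟨c, hc, hce⟩ := exists_of_sum_apply_ne_zero hno.1
    obtain ⟨d, hd, hde⟩ := exists_of_sum_apply_ne_zero hno.2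
    exact Set.disjoint_left.1 (h.disjoint_cycle_cocycle c hc d hd) hce hde
  · rw [modifiedTree, modifiedBasis, support_sum_of_disjoint h.disjoint_cycles,
      support_sum_of_disjoint h.disjoint_cocycles]

theorem exists_isReversal (hG : G.IsConnected)
    (H : SignedDuality G.flowSpace G.cutSpace {c | G.IsDirectedCycle c}
      {d | G.IsDirectedCocycle d} σ τ w w') {O : E → ℝ} (hO : O ∈ orientations E) :
    ∃ P T 𝒞 𝒟, G.IsReversal σ τ O P T 𝒞 𝒟 := by
  obtain ⟨P, T, K, D, u, v, h⟩ := H.exists_isVectorReversal hO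
  have hval : ∀ A : E → ℝ, (∀ e, A e = 0 ∨ A e = 2 * P e - 1) →
      ∀ e, A e = 0 ∨ A e = 1 ∨ A e = -1 := by
    intro A hA e
    refine (hA e).imp_right fun h1 => ?_
    rw [h1]
    exact two_mul_sub_one h.mem e
  obtain ⟨𝒞, h𝒞, hd𝒞, hs𝒞⟩ := H.left.exists_sum_disjoint _ K h.memK (hval K h.conformK) rfl
  obtain ⟨𝒟, h𝒟, hd𝒟, hs𝒟⟩ := H.right.exists_sum_disjoint _ D h.memD (hval D h.conformD) rfl
  refine ⟨P, T, 𝒞, 𝒟, ⟨h.mem, h.cert.orientedBy H h.basis⟩,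
    ⟨h.mem, h.cert.symm.orientedBy H.symm h.basis.symm⟩, (isSpanningTree_iff hG).2 h.basis,
    h.cert.eq_treeOrientation H h.basis h.mem,
    fun c hc => ⟨(h𝒞 c hc).1, isIn_of_conform (h𝒞 c hc).2 h.conformK⟩,
    fun d hd => ⟨(h𝒟 d hd).1, isIn_of_conform (h𝒟 d hd).2 h.conformD⟩, hd𝒞, hd𝒟,
    fun c hc d hd => ?_, by rw [hs𝒞, hs𝒟, h.eq]⟩
  rw [Set.disjoint_left]
  intro e hce hde
  have h1 := (h𝒞 c hc).2 e hce
  have h2 := (h𝒟 d hd).2 e hde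
  rcases h.disj e with h3 | h3
  · exact hce (h1.trans h3)
  · exact hde (h2.trans h3)

theorem phi_eq (hG : G.IsConnected)
    (H : SignedDuality G.flowSpace G.cutSpace {c | G.IsDirectedCycle c}
      {d | G.IsDirectedCocycle d} σ τ w w')
    {O P : E → ℝ} {T : Set E} {𝒞 𝒟 : Finset (E → ℝ)} (h : G.IsReversal σ τ O P T 𝒞 𝒟) :
    G.phi σ τ O = modifiedTree T 𝒞 𝒟 := by
  have hex : ∃ S, ∃ Ocp T 𝒞 𝒟, G.IsReversal σ τ O Ocp T 𝒞 𝒟 ∧ S = modifiedTree T 𝒞 𝒟 :=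
    ⟨_, P, T, 𝒞, 𝒟, h, rfl⟩
  rw [phi, dif_pos hex]
  obtain ⟨P', T', 𝒞', 𝒟', h', heq⟩ := hex.choose_spec
  rw [heq]
  obtain ⟨⟨u, v, hv⟩, hm⟩ := h.isVectorReversal hG H
  obtain ⟨⟨u', v', hv'⟩, hm'⟩ := h'.isVectorReversal hG H
  -- Two reversals producing the same orientation agree trivially, so the choice in `phi` is
  -- harmless.
  obtain ⟨hT, hK, hD, -⟩ := hv.eq_of_agree H hv' fun e => Or.inr rfl
  rw [hm, hm', hT, hK, hD]

/-- Every orientation has a description by vectors. -/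
theorem exists_isVectorReversal_phi (hG : G.IsConnected)
    (H : SignedDuality G.flowSpace G.cutSpace {c | G.IsDirectedCycle c}
      {d | G.IsDirectedCocycle d} σ τ w w') {O : E → ℝ} (hO : O ∈ orientations E) :
    ∃ P T K D u v, IsVectorReversal G.flowSpace G.cutSpace w w' O P T K D u v ∧
      G.phi σ τ O = modifiedBasis T K D := by
  obtain ⟨P, T, 𝒞, 𝒟, h⟩ := exists_isReversal hG H hO
  obtain ⟨⟨u, v, hv⟩, hm⟩ := h.isVectorReversal hG H
  exact ⟨P, T, _, _, u, v, hv, (phi_eq hG H h).trans hm⟩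

/-- Distinct orientations differ at an edge of the symmetric difference of their images. -/
theorem eq_of_phi_agree (hG : G.IsConnected)
    (H : SignedDuality G.flowSpace G.cutSpace {c | G.IsDirectedCycle c}
      {d | G.IsDirectedCocycle d} σ τ w w') {O₁ O₂ : E → ℝ} (h₁ : O₁ ∈ orientations E)
    (h₂ : O₂ ∈ orientations E)
    (h : ∀ e, (e ∈ G.phi σ τ O₁ ↔ e ∈ G.phi σ τ O₂) ∨ O₁ e = O₂ e) : O₁ = O₂ := by
  obtain ⟨P₁, T₁, K₁, D₁, u₁, v₁, r₁, e₁⟩ := exists_isVectorReversal_phi hG H h₁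
  obtain ⟨P₂, T₂, K₂, D₂, u₂, v₂, r₂, e₂⟩ := exists_isVectorReversal_phi hG H h₂
  rw [e₁, e₂] at h
  exact (r₁.eq_of_agree H r₂ h).2.2.2

/-! ### The cells -/

omit [Finite V] [Fintype E] in
theorem isStandardHalfOpenCell_hoc {O : E → ℝ} (hO : O ∈ orientations E) (S : Set E) :
    IsStandardHalfOpenCell (hoc O S) O S := by
  classical
  refine ⟨fun e => ?_, fun e => if e ∈ S then
    (if O e = 0 then Set.Ico (O e) (O e + 1) else Set.Ioc (O e - 1) (O e)) else {O e}, ?_,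
    fun e => ⟨fun he => if_neg he, fun he => ?_⟩⟩
  · rcases hO e with h | h
    · exact ⟨0, by simp [h]⟩
    · exact ⟨1, by simp [h]⟩
  · ext x
    simp only [hoc, cube, Set.mem_ofPred_eq, Set.mem_univ_pi]
    constructor
    · rintro ⟨-, h1, h2⟩ e
      by_cases he : e ∈ S
      · rw [if_pos he]
        have h3 := h2 e he
        rcases hO e with h | h <;> simp only [h, Set.mem_Ioo] at h3 ⊢ <;>
          rcases h3 with h3 | ⟨h3, h4⟩
        · simp [h3]
        · simp [h3.le, h4]
        · simp [h3]
        · simp [h3, h4.le]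
      · rw [if_neg he]
        exact h1 e he
    · intro h
      have key : ∀ e, x e ∈ Set.Icc (0 : ℝ) 1 ∧ (e ∉ S → x e = O e) ∧
          (e ∈ S → x e = O e ∨ x e ∈ Set.Ioo (0 : ℝ) 1) := by
        intro e
        have h3 := h e
        by_cases he : e ∈ S
        · rw [if_pos he] at h3
          rcases hO e with h4 | h4
          · rw [if_pos h4, h4] at h3
            rw [h4]
            refine ⟨⟨h3.1, by linarith [h3.2]⟩, fun h => absurd he h, fun _ => ?_⟩
            rcases h3.1.eq_or_lt with h5 | h5
            · exact Or.inl h5.symm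
            · exact Or.inr ⟨h5, by linarith [h3.2]⟩
          · rw [if_neg (by rw [h4]; exact one_ne_zero), h4] at h3
            rw [h4]
            refine ⟨⟨by linarith [h3.1], h3.2⟩, fun h => absurd he h, fun _ => ?_⟩
            rcases h3.2.eq_or_lt with h5 | h5
            · exact Or.inl h5
            · exact Or.inr ⟨by linarith [h3.1], h5⟩
        · rw [if_neg he, Set.mem_singleton_iff] at h3
          refine ⟨?_, fun _ => h3, fun h => absurd h he⟩
          rw [h3]
          rcases hO e with h4 | h4 <;> rw [h4] <;> constructor <;> norm_num
      exact ⟨fun e => (key e).1, fun e => (key e).2.1, fun e => (key e).2.2⟩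
  · simp only [if_pos he]
    split_ifs
    · exact Or.inr rfl
    · exact Or.inl rfl

/-- At an edge in only one of the two sets, a common point is pinned to `0` or `1` by the other
cell, so it cannot be bi-oriented there and the two orientations agree. -/
theorem pairwiseDisjoint_hoc (hG : G.IsConnected)
    (H : SignedDuality G.flowSpace G.cutSpace {c | G.IsDirectedCycle c}
      {d | G.IsDirectedCocycle d} σ τ w w') :
    (orientations E).PairwiseDisjoint fun O => hoc O (G.phi σ τ O) := by
  intro O₁ h₁ O₂ h₂ hne
  rw [Function.onFun, Set.disjoint_left]
  rintro x ⟨-, hx1, hx1'⟩ ⟨-, hx2, hx2'⟩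
  have hnot : ∀ O ∈ orientations E, ∀ e, O e ∉ Set.Ioo (0 : ℝ) 1 := by
    intro O hO e
    rcases hO e with h | h <;> simp [h]
  refine hne (eq_of_phi_agree hG H h₁ h₂ fun e => ?_)
  by_cases he1 : e ∈ G.phi σ τ O₁ <;> by_cases he2 : e ∈ G.phi σ τ O₂
  · exact Or.inl (iff_of_true he1 he2)
  · right
    have h3 := hx2 e he2
    rcases hx1' e he1 with h | h
    · exact h.symm.trans h3
    · exact absurd (h3 ▸ h) (hnot O₂ h₂ e)
  · right
    have h3 := hx1 e he1
    rcases hx2' e he2 with h | h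
    · exact h3.symm.trans h
    · exact absurd (h3 ▸ h) (hnot O₁ h₁ e)
  · exact Or.inl (iff_of_false he1 he2)

/-! ### Counting: all edge sets occur and the cells cover the cube. -/

open Classical in
/-- The orientation in which the edges of `A` keep their reference direction. -/
noncomputable def ofSet (A : Set E) : E → ℝ := fun e => if e ∈ A then 1 else 0

omit [Finite V] [Fintype E] in
theorem ofSet_mem (A : Set E) : ofSet A ∈ orientations E := by
  intro e
  unfold ofSet
  split_ifs <;> simp

omit [Finite V] [Fintype E] in
theorem ofSet_injective : Function.Injective (ofSet : Set E → E → ℝ) := by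
  intro A B h
  ext e
  have := congrFun h e
  unfold ofSet at this
  by_cases h1 : e ∈ A <;> by_cases h2 : e ∈ B <;> simp [h1, h2] at this ⊢

/-- The set attached to an orientation determines it, and every set occurs. -/
theorem bijective_phi_ofSet (hG : G.IsConnected)
    (H : SignedDuality G.flowSpace G.cutSpace {c | G.IsDirectedCycle c}
      {d | G.IsDirectedCocycle d} σ τ w w') :
    Function.Bijective fun A : Set E => G.phi σ τ (ofSet A) := by
  refine Finite.injective_iff_bijective.1 fun A B hAB => ofSet_injective ?_
  exact eq_of_phi_agree hG H (ofSet_mem A) (ofSet_mem B) fun e => Or.inl (by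
    have h : G.phi σ τ (ofSet A) = G.phi σ τ (ofSet B) := hAB
    rw [h])

theorem cube_subset_iUnion_hoc (hG : G.IsConnected)
    (H : SignedDuality G.flowSpace G.cutSpace {c | G.IsDirectedCycle c}
      {d | G.IsDirectedCocycle d} σ τ w w') {x : E → ℝ} (hx : x ∈ cube E) :
    ∃ O ∈ orientations E, x ∈ hoc O (G.phi σ τ O) := by
  choose ψ hψ using (bijective_phi_ofSet hG H).2
  simp only at hψ
  -- With `B` the bi-oriented edges, `R` ranges over subsets of the complement of `B`, and `ψ (B ∪
  -- R) \ B` records the directions off `B` of the orientation whose image is `B ∪ R`. Injectivity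
  -- of `F` gives surjectivity by finiteness, so every pattern of fixed directions occurs.
  let F : {p : Set E × Set E // Disjoint p.1 p.2} → {p : Set E × Set E // Disjoint p.1 p.2} :=
    fun p => ⟨(p.1.1, ψ (p.1.1 ∪ p.1.2) \ p.1.1), Set.disjoint_sdiff_right⟩
  have hF : Function.Injective F := by
    rintro ⟨⟨B, R⟩, h⟩ ⟨⟨B', R'⟩, h'⟩ heq
    simp only [F, Subtype.mk.injEq, Prod.mk.injEq] at heq
    obtain ⟨rfl, heq⟩ := heq
    simp only at h h'
    have hA : ofSet (ψ (B ∪ R)) = ofSet (ψ (B ∪ R')) := by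
      refine eq_of_phi_agree hG H (ofSet_mem _) (ofSet_mem _) fun e => ?_
      rw [hψ, hψ]
      by_cases he : e ∈ B
      · exact Or.inl (iff_of_true (Or.inl he) (Or.inl he))
      · right
        have h1 : e ∈ ψ (B ∪ R) ↔ e ∈ ψ (B ∪ R') := by
          have := congrArg (e ∈ ·) heq
          simpa [he] using this
        unfold ofSet
        by_cases h2 : e ∈ ψ (B ∪ R)
        · rw [if_pos h2, if_pos (h1.1 h2)]
        · rw [if_neg h2, if_neg fun h => h2 (h1.2 h)]
    have hU : B ∪ R = B ∪ R' := by
      rw [← hψ (B ∪ R), ← hψ (B ∪ R'), hA]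
    have hR : R = R' := by
      rw [← Set.union_sdiff_cancel_left (Set.disjoint_iff.1 h), hU,
        Set.union_sdiff_cancel_left (Set.disjoint_iff.1 h')]
    subst hR
    rfl
  obtain ⟨⟨⟨B, R⟩, hBR⟩, hp⟩ := Finite.surjective_of_injective hF
    ⟨({e | x e ∈ Set.Ioo (0 : ℝ) 1}, {e | x e = 1}), by
      rw [Set.disjoint_left]
      rintro e h1 h2
      exact absurd h1.2 (by rw [h2]; exact lt_irrefl _)⟩
  simp only [F, Subtype.mk.injEq, Prod.mk.injEq] at hp
  obtain ⟨rfl, hR⟩ := hp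
  set A := ψ ({e | x e ∈ Set.Ioo (0 : ℝ) 1} ∪ R) with hA
  have hval : ∀ e, x e ∈ Set.Ioo (0 : ℝ) 1 ∨ x e = ofSet A e := by
    intro e
    by_cases he : x e ∈ Set.Ioo (0 : ℝ) 1
    · exact Or.inl he
    · right
      have h1 : e ∈ A ↔ x e = 1 := by
        have h2 : e ∈ A \ {e | x e ∈ Set.Ioo (0 : ℝ) 1} ↔ e ∈ {e | x e = 1} := by rw [hR]
        exact ⟨fun h => h2.1 ⟨h, he⟩, fun h => (h2.2 h).1⟩
      unfold ofSet
      by_cases h2 : x e = 1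
      · rw [if_pos (h1.2 h2), h2]
      · rw [if_neg fun h => h2 (h1.1 h)]
        by_contra h3
        exact he ⟨lt_of_le_of_ne (hx e).1 (Ne.symm h3), lt_of_le_of_ne (hx e).2 h2⟩
  refine ⟨ofSet A, ofSet_mem A, hx, fun e he => ?_, fun e _ => (hval e).symm⟩
  refine (hval e).resolve_left fun h => he ?_
  rw [hA, hψ]
  exact Or.inl h

/-! ### Compatible orientations -/

/-- If `c ∈ σ` could be added to `x`, then `c` would point against `O` off the attached set.
Orthogonality to `D` makes `c` avoid `D`, and then `v ⬝ᵥ c ≤ 0`, against `w ⬝ᵥ c > 0`. -/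
theorem hoc_subset_contCompatible (hG : G.IsConnected)
    (H : SignedDuality G.flowSpace G.cutSpace {c | G.IsDirectedCycle c}
      {d | G.IsDirectedCocycle d} σ τ w w') {O : E → ℝ} (hO : O ∈ G.compatible σ) :
    hoc O (G.phi σ τ O) ⊆ contCompatible σ := by
  obtain ⟨P, T, K, D, u, v, r, hphi⟩ := exists_isVectorReversal_phi hG H hO.1
  have hK : K = 0 := (r.orientedBy_iff H).1 hO.2
  subst hK
  rintro x ⟨hx, hx1, -⟩
  refine ⟨hx, fun c hc ε hε hxc => ?_⟩
  have hcX := H.left.sig_mem c hc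
  have hval := H.left.values c hcX
  have hoff : ∀ e, e ∉ modifiedBasis T 0 D → (2 * O e - 1) * c e ≤ 0 := by
    intro e he
    have h1 := hx1 e (hphi ▸ he)
    have h2 := hxc e
    simp only [Pi.add_apply, Pi.smul_apply, smul_eq_mul, Set.mem_Icc, h1] at h2
    rcases hO.1 e with h | h <;> rw [h] at h2 ⊢ <;> nlinarith
  have h0 := H.left.dot_eq_zero (H.left.mem c hcX) r.memD
  have hpos : ∀ e, 0 ≤ c e * D e := by
    intro e
    by_cases hD : D e = 0
    · simp [hD]
    have h1 := r.sign_of_D_ne hD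
    have h2 := hoff e (by rw [mem_modifiedBasis]; tauto)
    rw [h1] at h2
    linarith
  rw [dotProduct, Finset.sum_eq_zero_iff_of_nonneg fun e _ => hpos e] at h0
  have hle : v ⬝ᵥ c ≤ 0 := by
    refine Finset.sum_nonpos fun e _ => ?_
    by_cases he : e ∈ T
    · simp [r.cert.v_zero e he]
    by_cases hce : c e = 0
    · simp [hce]
    have hD := (mul_eq_zero.1 (h0 e (Finset.mem_univ e))).resolve_left hce
    have h1 := r.cert.v_sign e he
    have h2 := hoff e (by rw [mem_modifiedBasis]; simp [he])
    rw [r.eq_of_zero rfl hD] at h2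
    rcases two_mul_sub_one r.mem e with h | h <;> rw [h] at h1 h2 <;> nlinarith
  rw [H.left.dot_congr (H.left.mem c hcX) r.cert.v_mem] at hle
  exact absurd (H.left.pos c hc) (not_lt.2 hle)

/-- An orientation that is not compatible contains the reversal of a chosen cycle in its image. -/
theorem exists_cycle_of_not_compatible (hG : G.IsConnected)
    (H : SignedDuality G.flowSpace G.cutSpace {c | G.IsDirectedCycle c}
      {d | G.IsDirectedCocycle d} σ τ w w') {O : E → ℝ} (hO : O ∈ orientations E)
    (hOσ : O ∉ G.compatible σ) :
    ∃ c ∈ σ, Function.support c ⊆ G.phi σ τ O ∧ ∀ e, c e ≠ 0 → c e = 1 - 2 * O e := by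
  obtain ⟨P, T, K, D, u, v, r, hphi⟩ := exists_isVectorReversal_phi hG H hO
  have hK : K ≠ 0 := fun hK => hOσ ⟨hO, (r.orientedBy_iff H).2 hK⟩
  obtain ⟨c, hc, hcK⟩ := H.left.conformal K r.memK hK
  have hKval : ∀ e, K e = 0 ∨ K e = 1 ∨ K e = -1 := by
    intro e
    refine (r.conformK e).imp_right fun h1 => ?_
    rw [h1]
    exact two_mul_sub_one r.mem e
  have hceq : ∀ e, c e ≠ 0 → c e = K e := fun e he =>
    SignedSpace.sign_eq (H.left.values c hc e) (hKval e) (hcK e he)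
  refine ⟨c, r.cert.orientedBy H r.basis c hc (isIn_of_conform hceq r.conformK), fun e he => ?_,
    fun e he => ?_⟩
  · have hKe : K e ≠ 0 := by rw [← hceq e he]; exact he
    rw [hphi, mem_modifiedBasis]
    exact ⟨Or.inr hKe, (r.sign_of_K_ne hKe).1⟩
  · have hKe : K e ≠ 0 := by rw [← hceq e he]; exact he
    have := (r.sign_of_K_ne hKe).2
    rw [hceq e he]
    linarith

omit [Finite V] in
-- On the support of `c` a point of the cell is either at `O` or interior, and `c` points away from
-- `O` into the cube.
theorem exists_flow_step {O x c : E → ℝ} {S : Set E} (hO : O ∈ orientations E)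
    (hx : x ∈ hoc O S) (hs : Function.support c ⊆ S) (hc : ∀ e, c e ≠ 0 → c e = 1 - 2 * O e) :
    ∃ ε : ℝ, 0 < ε ∧ x + ε • c ∈ cube E := by
  have h : ∀ e, ∃ ε : ℝ, 0 < ε ∧ (c e ≠ 0 → ∀ s : ℝ, 0 ≤ s → s ≤ ε → x e + s * c e ∈ Set.Icc (0 : ℝ) 1) := by
    intro e
    by_cases hce : c e = 0
    · exact ⟨1, one_pos, fun h => absurd hce h⟩
    have h1 := hx.2.2 e (hs hce)
    have h2 := hc e hce
    have h3 := hx.1 e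
    rcases hO e with h | h <;> rw [h] at h1 h2
    · refine ⟨1 - x e, ?_, fun _ s hs hs' => ?_⟩
      · rcases h1 with h1 | h1
        · rw [h1]; norm_num
        · linarith [h1.2]
      · rw [h2]
        constructor <;> linarith [h3.1]
    · refine ⟨x e, ?_, fun _ s hs hs' => ?_⟩
      · rcases h1 with h1 | h1
        · rw [h1]; norm_num
        · exact h1.1
      · rw [h2]
        constructor <;> linarith [h3.2]
  choose t ht hts using h
  by_cases hE : Nonempty E
  · obtain ⟨e₀, -, he₀⟩ := Finset.exists_min_image Finset.univ t Finset.univ_nonempty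
    refine ⟨t e₀, ht e₀, fun e => ?_⟩
    by_cases hce : c e = 0
    · simpa [hce] using hx.1 e
    · exact hts e hce _ (ht e₀).le (he₀ e (Finset.mem_univ e))
  · rw [not_nonempty_iff] at hE
    exact ⟨1, one_pos, fun e => hE.elim e⟩

theorem disjoint_hoc_contCompatible (hG : G.IsConnected)
    (H : SignedDuality G.flowSpace G.cutSpace {c | G.IsDirectedCycle c}
      {d | G.IsDirectedCocycle d} σ τ w w') {O : E → ℝ} (hO : O ∈ orientations E)
    (hOσ : O ∉ G.compatible σ) : Disjoint (hoc O (G.phi σ τ O)) (contCompatible σ) := by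
  rw [Set.disjoint_left]
  intro x hx hxσ
  obtain ⟨c, hc, hs, hce⟩ := exists_cycle_of_not_compatible hG H hO hOσ
  obtain ⟨ε, hε, hmem⟩ := exists_flow_step hO hx hs hce
  exact hxσ.2 c hc ε hε hmem

theorem phi_isSpanningForest (hG : G.IsConnected)
    (H : SignedDuality G.flowSpace G.cutSpace {c | G.IsDirectedCycle c}
      {d | G.IsDirectedCocycle d} σ τ w w') {O : E → ℝ} (hO : O ∈ G.compatible σ) :
    G.IsSpanningForest (G.phi σ τ O) := by
  obtain ⟨P, T, K, D, u, v, r, hphi⟩ := exists_isVectorReversal_phi hG H hO.1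
  have hK : K = 0 := (r.orientedBy_iff H).1 hO.2
  intro C hC hCs
  refine ((isSpanningTree_iff hG).2 r.basis).2 C hC fun e he => ?_
  have := hCs he
  rw [hphi, mem_modifiedBasis, hK] at this
  simpa using this.1

theorem bijOn_phi (hG : G.IsConnected)
    (H : SignedDuality G.flowSpace G.cutSpace {c | G.IsDirectedCycle c}
      {d | G.IsDirectedCocycle d} σ τ w w') :
    Set.BijOn (G.phi σ τ) (G.compatible σ) {F | G.IsSpanningForest F} := by
  refine ⟨fun O hO => phi_isSpanningForest hG H hO, fun O₁ h₁ O₂ h₂ h => ?_, fun F hF => ?_⟩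
  · exact eq_of_phi_agree hG H h₁.1 h₂.1 fun e => Or.inl (by rw [h])
  · obtain ⟨A, hA⟩ := (bijective_phi_ofSet hG H).2 F
    simp only at hA
    refine ⟨ofSet A, ?_, hA⟩
    -- An incompatible orientation would have a cycle inside its image, which is the forest `F`.
    by_contra hno
    obtain ⟨c, hc, hs, -⟩ := exists_cycle_of_not_compatible hG H (ofSet_mem A) hno
    exact hF _ ⟨c, H.left.sig_mem c hc, rfl⟩ (hA ▸ hs)

theorem IsReversal.cycles_eq_empty (hG : G.IsConnected)
    (H : SignedDuality G.flowSpace G.cutSpace {c | G.IsDirectedCycle c}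
      {d | G.IsDirectedCocycle d} σ τ w w') {O P : E → ℝ} {T : Set E} {𝒞 𝒟 : Finset (E → ℝ)}
    (hO : O ∈ G.compatible σ) (h : G.IsReversal σ τ O P T 𝒞 𝒟) : 𝒞 = ∅ := by
  obtain ⟨⟨u, v, r⟩, -⟩ := h.isVectorReversal hG H
  have hK := (r.orientedBy_iff H).1 hO.2
  rw [Finset.eq_empty_iff_forall_notMem]
  intro c hc
  refine (h.cycles c hc).1.ne_zero (funext fun e => ?_)
  by_contra he
  have := sum_apply_of_disjoint h.disjoint_cycles hc he
  rw [hK] at this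
  exact he this.symm

end OrientedMultigraph

open OrientedMultigraph in
theorem proposition4p7 {V E : Type*} [Finite V] [Fintype E] (G : OrientedMultigraph V E)
    (hG : G.IsConnected) (σ τ : Finset (E → ℝ))
    (hσ : G.IsCycleSignature σ) (hσa : IsAcyclic σ)
    (hτ : G.IsCocycleSignature τ) (hτa : IsAcyclic τ) :
    -- the map `φ_{σ,τ}` is well defined on all orientations
    (∀ O ∈ orientations E,
      (∃ Ocp T 𝒞 𝒟, G.IsReversal σ τ O Ocp T 𝒞 𝒟) ∧
      ∀ Ocp T 𝒞 𝒟, G.IsReversal σ τ O Ocp T 𝒞 𝒟 → G.phi σ τ O = modifiedTree T 𝒞 𝒟) ∧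
    -- `S_σ` is the disjoint union of the cells of the `σ`-compatible orientations
    (contCompatible σ = ⋃ O ∈ G.compatible σ, hoc O (G.phi σ τ O)) ∧
    (G.compatible σ).PairwiseDisjoint (fun O => hoc O (G.phi σ τ O)) ∧
    -- each cell is a standard half-open cell with lattice point `O` and generating set `φ(O)`
    (∀ O ∈ orientations E, IsStandardHalfOpenCell (hoc O (G.phi σ τ O)) O (G.phi σ τ O)) ∧
    -- the cells of all orientations tile the cube, and this tiling restricts to that of `S_σ`
    (cube E = ⋃ O ∈ orientations E, hoc O (G.phi σ τ O)) ∧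
    (orientations E).PairwiseDisjoint (fun O => hoc O (G.phi σ τ O)) ∧
    (∀ O ∈ G.compatible σ, hoc O (G.phi σ τ O) ⊆ contCompatible σ) ∧
    (∀ O ∈ orientations E, O ∉ G.compatible σ →
      Disjoint (hoc O (G.phi σ τ O)) (contCompatible σ)) ∧
    -- sending the lattice point of a cell to the generating set is the bijection from
    -- `σ`-compatible orientations to spanning forests, for which no cycles have to be reversed
    Set.BijOn (G.phi σ τ) (G.compatible σ) {F | G.IsSpanningForest F} ∧
    (∀ O ∈ G.compatible σ, ∀ Ocp T 𝒞 𝒟, G.IsReversal σ τ O Ocp T 𝒞 𝒟 →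
      𝒞 = ∅ ∧ G.phi σ τ O = T \ ⋃ d ∈ 𝒟, Function.support d) := by
  obtain ⟨w, w', H⟩ := exists_signedDuality hσ hσa hτ hτa
  refine ⟨fun O hO => ⟨exists_isReversal hG H hO, fun P T 𝒞 𝒟 h => phi_eq hG H h⟩, ?_,
    (pairwiseDisjoint_hoc hG H).subset fun O hO => hO.1,
    fun O hO => isStandardHalfOpenCell_hoc hO _, ?_, pairwiseDisjoint_hoc hG H,
    fun O hO => hoc_subset_contCompatible hG H hO,
    fun O hO hOσ => disjoint_hoc_contCompatible hG H hO hOσ, bijOn_phi hG H,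
    fun O hO P T 𝒞 𝒟 h => ?_⟩
  -- A point of `S_σ` lies in some cell of the cube tiling, and cells of incompatible orientations
  -- miss `S_σ`.
  · refine Set.Subset.antisymm (fun x hx => ?_)
      (Set.iUnion₂_subset fun O hO => hoc_subset_contCompatible hG H hO)
    obtain ⟨O, hO, hxO⟩ := cube_subset_iUnion_hoc hG H hx.1
    refine Set.mem_iUnion₂.2 ⟨O, ?_, hxO⟩
    by_contra hno
    exact Set.disjoint_left.1 (disjoint_hoc_contCompatible hG H hO hno) hxO hx
  · refine Set.Subset.antisymm (fun x hx => ?_) (Set.iUnion₂_subset fun O _ x hx => hx.1)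
    obtain ⟨O, hO, hxO⟩ := cube_subset_iUnion_hoc hG H hx
    exact Set.mem_iUnion₂.2 ⟨O, hO, hxO⟩
  · have h𝒞 := h.cycles_eq_empty hG H hO
    refine ⟨h𝒞, ?_⟩
    rw [phi_eq hG H h, h𝒞]
    simp [modifiedTree]
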